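/- **Theorem.** There are a deterministic algorithm on the word RAM (unit cost per word operation) and absolute constants $c, C, k$ such that the following holds. Let $G=(V,E)$ be a directed or undirected unweighted graph (undirected graphs simple; directed graphs without parallel arcs, loops allowed) with $n\ge 1$ vertices and $m$ edges and with finite diameter $D=3h+z$, where $h\ge 0$ and $z\in\{0,1,2\}$ are integers; here $D=\max_{u,v\in V} d(u,v)$, and $d(u,v)$ is the least length of a (directed, if $G$ is directed) path from $u$ to $v$. The input is $n$, the number of arcs, and a list, in any order, of the arcs of $G$, where an undirected edge is listed as two opposite arcs. Then, on every such machine whose words have at least $c\log_2(n+2)$ bits, the algorithm halts after at most $$C\,\bigl(m^{2/3}\,n^{4/3}\,(\log n)^k+1\bigr)$$ steps, that is, in $\tilde O(m^{2/3}n^{4/3})$ time, and reports an integer $\hat D$ with $$2h+z\;\le\;\hat D\;\le\; D .$$ -/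

import Mathlib

/-! ### A deterministic word RAM

Programs are built from assignments, conditionals and loops over finitely many word variables and
finitely many arrays of words. Words have `w` bits; results of operations are taken modulo `2 ^ w`.
Every operation, every access to a variable or to an array cell, and every test costs one step. -/

namespace WordRAM

/-- The operations on machine words. -/
inductive Op where
  | add | sub | mul | div | lt | eq

/-- Truncated subtraction, integer division (by zero: `0`), and tests with value `1` or `0`. -/
def Op.apply : Op → ℕ → ℕ → ℕ
  | .add, a, b => a + b
  | .sub, a, b => a - b
  | .mul, a, b => a * b
  | .div, a, b => a / b
  | .lt, a, b => if a < b then 1 else 0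
  | .eq, a, b => if a = b then 1 else 0

/-- The contents of the memory: the variables `var x`, and the cells `arr a i` of the arrays. -/
structure State where
  var : ℕ → ℕ
  arr : ℕ → ℕ → ℕ

/-- Expressions: a constant, a variable, the cell of an array at a computed index, an operation. -/
inductive Expr where
  | const (k : ℕ)
  | var (x : ℕ)
  | read (a : ℕ) (i : Expr)
  | op (o : Op) (e₁ e₂ : Expr)

/-- The value of an expression on a machine with words of `w` bits. -/
def Expr.eval (w : ℕ) (σ : State) : Expr → ℕ
  | .const k => k % 2 ^ w
  | .var x => σ.var x
  | .read a i => σ.arr a (i.eval w σ)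
  | .op o e₁ e₂ => o.apply (e₁.eval w σ) (e₂.eval w σ) % 2 ^ w

/-- The number of steps needed to evaluate an expression: one for each of its nodes. -/
def Expr.cost : Expr → ℕ
  | .const _ => 1
  | .var _ => 1
  | .read _ i => i.cost + 1
  | .op _ e₁ e₂ => e₁.cost + e₂.cost + 1

/-- Programs: do nothing, assign to a variable, store into the cell of an array at a computed index,
sequential composition, conditional, loop. A test succeeds if its value is not `0`. -/
inductive Program where
  | skip
  | assign (x : ℕ) (e : Expr)
  | store (a : ℕ) (i e : Expr)
  | seq (p q : Program)
  | ite (e : Expr) (p q : Program)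
  | loop (e : Expr) (p : Program)

/-- Replace the content of the variable `x`. -/
def State.setVar (σ : State) (x v : ℕ) : State where
  var := Function.update σ.var x v
  arr := σ.arr

/-- Replace the content of the cell `i` of the array `a`. -/
def State.setArr (σ : State) (a i v : ℕ) : State where
  var := σ.var
  arr := Function.update σ.arr a (Function.update (σ.arr a) i v)

/-- `Exec w p σ t τ`: on a machine with words of `w` bits, the program `p` started in the state `σ`
halts after exactly `t` steps, in the state `τ`. -/
inductive Exec (w : ℕ) : Program → State → ℕ → State → Prop
  | skip (σ : State) : Exec w .skip σ 1 σ
  | assign (σ : State) (x : ℕ) (e : Expr) :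
      Exec w (.assign x e) σ (e.cost + 1) (σ.setVar x (e.eval w σ))
  | store (σ : State) (a : ℕ) (i e : Expr) :
      Exec w (.store a i e) σ (i.cost + e.cost + 1) (σ.setArr a (i.eval w σ) (e.eval w σ))
  | seq {p q : Program} {σ τ υ : State} {s t : ℕ}
      (hp : Exec w p σ s τ) (hq : Exec w q τ t υ) : Exec w (.seq p q) σ (s + t) υ
  | ite_true {e : Expr} {p q : Program} {σ τ : State} {t : ℕ}
      (he : e.eval w σ ≠ 0) (hp : Exec w p σ t τ) : Exec w (.ite e p q) σ (e.cost + 1 + t) τ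
  | ite_false {e : Expr} {p q : Program} {σ τ : State} {t : ℕ}
      (he : e.eval w σ = 0) (hq : Exec w q σ t τ) : Exec w (.ite e p q) σ (e.cost + 1 + t) τ
  | loop_true {e : Expr} {p : Program} {σ τ υ : State} {s t : ℕ}
      (he : e.eval w σ ≠ 0) (hp : Exec w p σ s τ) (hw : Exec w (.loop e p) τ t υ) :
      Exec w (.loop e p) σ (e.cost + 1 + s + t) υ
  | loop_false {e : Expr} {p : Program} {σ : State}
      (he : e.eval w σ = 0) : Exec w (.loop e p) σ (e.cost + 1) σ

/-- The machine is deterministic: the running time and the final state are determined by the word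
length, the program and the initial state. -/
theorem Exec.deterministic {w : ℕ} {p : Program} {σ τ τ' : State} {t t' : ℕ}
    (h : Exec w p σ t τ) (h' : Exec w p σ t' τ') : t = t' ∧ τ = τ' := by
  induction h generalizing t' τ' with
  | skip σ => cases h'; exact ⟨rfl, rfl⟩
  | assign σ x e => cases h'; exact ⟨rfl, rfl⟩
  | store σ a i e => cases h'; exact ⟨rfl, rfl⟩
  | seq hp hq ihp ihq =>
    cases h' with
    | seq hp' hq' =>
      obtain ⟨rfl, rfl⟩ := ihp hp'
      obtain ⟨rfl, rfl⟩ := ihq hq'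
      exact ⟨rfl, rfl⟩
  | ite_true he hp ih =>
    cases h' with
    | ite_true he' hp' => obtain ⟨rfl, rfl⟩ := ih hp'; exact ⟨rfl, rfl⟩
    | ite_false he' hq' => exact absurd he' he
  | ite_false he hq ih =>
    cases h' with
    | ite_true he' hp' => exact absurd he he'
    | ite_false he' hq' => obtain ⟨rfl, rfl⟩ := ih hq'; exact ⟨rfl, rfl⟩
  | loop_true he hp hw ihp ihw =>
    cases h' with
    | loop_true he' hp' hw' =>
      obtain ⟨rfl, rfl⟩ := ihp hp'
      obtain ⟨rfl, rfl⟩ := ihw hw'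
      exact ⟨rfl, rfl⟩
    | loop_false he' => exact absurd he' he
  | loop_false he =>
    cases h' with
    | loop_true he' hp' hw' => exact absurd he he'
    | loop_false he' => exact ⟨rfl, rfl⟩

end WordRAM

/-! ### Graphs as inputs -/

/-- `l` lists every arc `(u, v)` of the relation `r` exactly once, in any order. -/
def IsArcList {n : ℕ} (r : Fin n → Fin n → Prop) (l : List (Fin n × Fin n)) : Prop :=
  l.Nodup ∧ ∀ u v, (u, v) ∈ l ↔ r u v

/-- The memory that holds a list of arcs between `n` vertices as input: the variable `0` holds `n`,
the variable `1` the number of arcs, and the cells `i` of the arrays `0` and `1` the tail and the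
head of the `i`-th arc; everything else is `0`. -/
def arcInput (n : ℕ) (l : List (Fin n × Fin n)) : WordRAM.State where
  var x := if x = 0 then n else if x = 1 then l.length else 0
  arr a i :=
    match l[i]? with
    | none => 0
    | some e => if a = 0 then (e.1 : ℕ) else if a = 1 then (e.2 : ℕ) else 0

/-- With words of `w` bits, the program `P` halts on the arcs `l` between `n` vertices after at most
`T` steps, with the value `d` in the variable `0`. -/
def ReportsWithin (P : WordRAM.Program) (w n : ℕ) (l : List (Fin n × Fin n)) (T : ℝ) (d : ℕ) :
    Prop :=
  ∃ (t : ℕ) (τ : WordRAM.State),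
    WordRAM.Exec w P (arcInput n l) t τ ∧ (t : ℝ) ≤ T ∧ τ.var 0 = d

/-! ### Distances in directed graphs -/

namespace Digraph

variable {V : Type*} (G : Digraph V)

/-- There is a directed walk of length `k` from `u` to `v`. -/
def HasWalk : ℕ → V → V → Prop
  | 0, u, v => u = v
  | k + 1, u, v => ∃ x, G.Adj u x ∧ HasWalk k x v

/-- The distance from `u` to `v`: the least length of a directed walk, `⊤` if there is none. -/
noncomputable def edist (u v : V) : ℕ∞ :=
  ⨅ (k : ℕ) (_ : G.HasWalk k u v), (k : ℕ∞)

/-- The diameter: the largest distance, `⊤` if some vertex cannot be reached from another one. -/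
noncomputable def ediam : ℕ∞ :=
  ⨆ (u : V) (v : V), G.edist u v

/-- The number of arcs. -/
noncomputable def numArcs : ℕ :=
  {e : V × V | G.Adj e.1 e.2}.ncard

end Digraph

/-!
The algorithm rests on balls of size `s`, where `s` is about `(m / n) ^ (1 / 3)`. For every vertex
`u`, let `B u` consist of the `s` vertices that are closest from `u`, and let `R u` be the largest
distance from `u` to a vertex of `B u`; then `B u` contains every vertex at a distance less than
`R u`. Let `B' v` and `R' v` be the same in the reversed graph. Two lower bounds for the diameter are
computed, and the larger one is reported.

* A set `S` that meets all balls is chosen greedily, and the eccentricities of its vertices are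
  found by breadth-first search, forwards or backwards. Suppose `d a b = 3 * h + z` is the
  diameter. If `R a ≤ h`, then `S` contains a vertex within distance `h` of `a`, from which `b` is
  at a distance of at least `2 * h + z`. If `R' b ≤ h`, the same argument applies in the reversed
  graph.
* For all `u ≠ v`, the minimum of `R u + R' v` and of the lengths `d u x + 1 + d y v`, over the
  arcs from some `x` in `B u` to some `y` in `B' v`, equals the smaller one of `R u + R' v` and
  `d u v` (`estimate_le`): a shortest path that is shorter than `R u + R' v` has an arc from `B u` to
  `B' v`. If `R a` and `R' b` both exceed `h`, this value is at least `min (2 * h + 2) (3 * h + z)`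
  at the pair `(a, b)`, which suffices as `z ≤ 2` (`estimate_ge`).

The pairs take `O(n ^ 2 * s ^ 2)` steps. The number of greedy rounds is `O((n / s) * log n)`: as
long as `k` balls have not been hit, some vertex hits a fraction `s / (2 * n)` of them, which
lowers the potential given by the harmonic number of `k` by as much (`harmonic_gain`). A round
takes `O(n * s + m)` steps. Both totals are `O(m ^ (2 / 3) * n ^ (4 / 3) * log n)` by the choice of
`s` (`steps_le`).

Forward and backward searches are treated alike by passing to a doubled graph on `2 * n` vertices:
the given graph on the vertices below `n`, and a copy with all arcs reversed on the others. An
undirected graph is a directed graph with `m` replaced by `2 * m`.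

Programs are verified by weakest-precondition rules (`WP`) that carry the exact number of steps.
What a program does not write is known to be unchanged (`Exec.frame`), so that loop invariants
mention only what changes. The numerical constants in time bounds are generous.
-/

namespace WordRAM

/-! ### Reasoning about programs -/

/-- Total correctness with running time: the program `p` started in `σ` halts, after a number of
steps `t` and in a state `τ` that satisfy `Q t τ`. -/
def WP (w : ℕ) (p : Program) (σ : State) (Q : ℕ → State → Prop) : Prop :=
  ∃ t τ, Exec w p σ t τ ∧ Q t τ

/-- Whether the variable `x` is assigned somewhere in the program. -/
def Program.modVar : Program → ℕ → Bool
  | .skip, _ => false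
  | .assign y _, x => y == x
  | .store _ _ _, _ => false
  | .seq p q, x => p.modVar x || q.modVar x
  | .ite _ p q, x => p.modVar x || q.modVar x
  | .loop _ p, x => p.modVar x

/-- Whether the program stores somewhere into the array `a`. -/
def Program.modArr : Program → ℕ → Bool
  | .skip, _ => false
  | .assign _ _, _ => false
  | .store b _ _, a => b == a
  | .seq p q, a => p.modArr a || q.modArr a
  | .ite _ p q, a => p.modArr a || q.modArr a
  | .loop _ p, a => p.modArr a

/-- The states `σ` and `τ` agree on everything that the program `p` does not write. -/
structure Program.Frame (p : Program) (σ τ : State) : Prop where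
  var : ∀ x, p.modVar x = false → τ.var x = σ.var x
  arr : ∀ a, p.modArr a = false → τ.arr a = σ.arr a

theorem Program.Frame.refl (p : Program) (σ : State) : p.Frame σ σ :=
  ⟨fun _ _ => rfl, fun _ _ => rfl⟩

theorem Program.Frame.trans {p : Program} {σ τ υ : State} (h : p.Frame σ τ) (h' : p.Frame τ υ) :
    p.Frame σ υ :=
  ⟨fun x hx => (h'.var x hx).trans (h.var x hx), fun a ha => (h'.arr a ha).trans (h.arr a ha)⟩

theorem Exec.frame {w : ℕ} {p : Program} {σ τ : State} {t : ℕ} (h : Exec w p σ t τ) :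
    p.Frame σ τ := by
  induction h with
  | skip σ => exact .refl _ _
  | assign σ x e =>
    refine ⟨fun y hy => ?_, fun _ _ => rfl⟩
    have : y ≠ x := by rintro rfl; simp [Program.modVar] at hy
    simp [State.setVar, this]
  | store σ a i e =>
    refine ⟨fun _ _ => rfl, fun b hb => ?_⟩
    have : b ≠ a := by rintro rfl; simp [Program.modArr] at hb
    simp [State.setArr, this]
  | seq hp hq ihp ihq =>
    refine ⟨fun x hx => ?_, fun a ha => ?_⟩
    · simp only [Program.modVar, Bool.or_eq_false_iff] at hx
      rw [ihq.var x hx.2, ihp.var x hx.1]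
    · simp only [Program.modArr, Bool.or_eq_false_iff] at ha
      rw [ihq.arr a ha.2, ihp.arr a ha.1]
  | ite_true he hp ih =>
    refine ⟨fun x hx => ?_, fun a ha => ?_⟩
    · simp only [Program.modVar, Bool.or_eq_false_iff] at hx
      exact ih.var x hx.1
    · simp only [Program.modArr, Bool.or_eq_false_iff] at ha
      exact ih.arr a ha.1
  | ite_false he hp ih =>
    refine ⟨fun x hx => ?_, fun a ha => ?_⟩
    · simp only [Program.modVar, Bool.or_eq_false_iff] at hx
      exact ih.var x hx.2
    · simp only [Program.modArr, Bool.or_eq_false_iff] at ha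
      exact ih.arr a ha.2
  | loop_true he hp hw ihp ihw =>
    exact ⟨fun x hx => (ihw.var x hx).trans (ihp.var x hx),
      fun a ha => (ihw.arr a ha).trans (ihp.arr a ha)⟩
  | loop_false he => exact .refl _ _

section

variable {w : ℕ} {p q : Program} {σ : State} {Q R : ℕ → State → Prop}

theorem WP.mono (h : WP w p σ Q) (hQ : ∀ t τ, p.Frame σ τ → Q t τ → R t τ) : WP w p σ R := by
  obtain ⟨t, τ, he, hq⟩ := h
  exact ⟨t, τ, he, hQ t τ he.frame hq⟩

theorem WP.skip (h : Q 1 σ) : WP w .skip σ Q := ⟨_, _, .skip σ, h⟩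

theorem WP.assign {x : ℕ} {e : Expr} {v : ℕ} (hv : e.eval w σ = v)
    (h : Q (e.cost + 1) (σ.setVar x v)) : WP w (.assign x e) σ Q :=
  ⟨_, _, .assign σ x e, hv ▸ h⟩

theorem WP.store {a : ℕ} {i e : Expr} {j v : ℕ} (hj : i.eval w σ = j) (hv : e.eval w σ = v)
    (h : Q (i.cost + e.cost + 1) (σ.setArr a j v)) : WP w (.store a i e) σ Q :=
  ⟨_, _, .store σ a i e, hj ▸ hv ▸ h⟩

theorem WP.seq (h : WP w p σ fun t τ => WP w q τ fun t' υ => Q (t + t') υ) :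
    WP w (.seq p q) σ Q := by
  obtain ⟨t, τ, hp, t', υ, hq, h⟩ := h
  exact ⟨_, _, .seq hp hq, h⟩

theorem WP.ite {e : Expr} (h₁ : e.eval w σ ≠ 0 → WP w p σ fun t τ => Q (e.cost + 1 + t) τ)
    (h₂ : e.eval w σ = 0 → WP w q σ fun t τ => Q (e.cost + 1 + t) τ) :
    WP w (.ite e p q) σ Q := by
  by_cases he : e.eval w σ = 0
  · obtain ⟨t, τ, hq, h⟩ := h₂ he
    exact ⟨_, _, .ite_false he hq, h⟩
  · obtain ⟨t, τ, hq, h⟩ := h₁ he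
    exact ⟨_, _, .ite_true he hq, h⟩

/-- The loop rule, with time credits: `I T σ` is an invariant that promises that the loop, started
in `σ`, halts within `T` steps. -/
theorem WP.loop {e : Expr} {I : ℕ → State → Prop} {T : ℕ}
    (h : ∀ T τ, p.Frame σ τ → I T τ → e.eval w τ ≠ 0 →
      WP w p τ fun t υ => ∃ T', e.cost + 1 + t + T' ≤ T ∧ I T' υ)
    (h₀ : ∀ T τ, I T τ → e.eval w τ = 0 → e.cost + 1 ≤ T) (hI : I T σ) :
    WP w (.loop e p) σ fun t τ => t ≤ T ∧ e.eval w τ = 0 ∧ ∃ T', I T' τ := by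
  suffices ∀ T τ, p.Frame σ τ → I T τ →
      WP w (.loop e p) τ fun t υ => t ≤ T ∧ e.eval w υ = 0 ∧ ∃ T', I T' υ from
    this T σ (.refl _ _) hI
  intro T
  induction T using Nat.strong_induction_on with
  | _ T ih =>
    intro τ hτ hI
    by_cases he : e.eval w τ = 0
    · exact ⟨_, _, .loop_false he, h₀ T τ hI he, he, T, hI⟩
    · obtain ⟨t, υ, hp, T', hT', hI'⟩ := h T τ hτ hI he
      obtain ⟨t', φ, hw, ht', hφ⟩ := ih T' (by omega) υ (hτ.trans hp.frame) hI'
      exact ⟨_, _, .loop_true he hp hw, by omega, hφ⟩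

/-- For `x` from `0` up to, but not including, the value of the variable `b`, do `p`. -/
def forTo (x b : ℕ) (p : Program) : Program :=
  .seq (.assign x (.const 0))
    (.loop (.op .lt (.var x) (.var b)) (.seq p (.assign x (.op .add (.var x) (.const 1)))))

@[simp] theorem setVar_arr (σ : State) (x v : ℕ) : (σ.setVar x v).arr = σ.arr := rfl

@[simp] theorem setArr_var (σ : State) (a i v : ℕ) : (σ.setArr a i v).var = σ.var := rfl

@[simp] theorem setVar_var_self (σ : State) (x v : ℕ) : (σ.setVar x v).var x = v := by
  simp [State.setVar]

@[simp] theorem setVar_var_ne (σ : State) {x y : ℕ} (v : ℕ) (h : y ≠ x) :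
    (σ.setVar x v).var y = σ.var y := by
  simp [State.setVar, h]

@[simp] theorem setArr_arr_self (σ : State) (a i v : ℕ) :
    (σ.setArr a i v).arr a = Function.update (σ.arr a) i v := by
  simp [State.setArr]

@[simp] theorem setArr_arr_ne (σ : State) {a b : ℕ} (i v : ℕ) (h : b ≠ a) :
    (σ.setArr a i v).arr b = σ.arr b := by
  simp [State.setArr, h]

theorem eval_const {k : ℕ} (h : k < 2 ^ w) : (Expr.const k).eval w σ = k := Nat.mod_eq_of_lt h

theorem eval_var {x v : ℕ} (h : σ.var x = v) : (Expr.var x).eval w σ = v := h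

theorem eval_read {a j v : ℕ} {i : Expr} (hi : i.eval w σ = j) (hj : σ.arr a j = v) :
    (Expr.read a i).eval w σ = v := by
  rw [Expr.eval, hi, hj]

theorem eval_add {a b : Expr} {x y : ℕ} (ha : a.eval w σ = x) (hb : b.eval w σ = y)
    (h : x + y < 2 ^ w) : (Expr.op .add a b).eval w σ = x + y := by
  rw [Expr.eval, ha, hb]
  exact Nat.mod_eq_of_lt h

theorem eval_sub {a b : Expr} {x y : ℕ} (ha : a.eval w σ = x) (hb : b.eval w σ = y)
    (h : x < 2 ^ w) : (Expr.op .sub a b).eval w σ = x - y := by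
  rw [Expr.eval, ha, hb]
  exact Nat.mod_eq_of_lt ((Nat.sub_le _ _).trans_lt h)

theorem eval_mul {a b : Expr} {x y : ℕ} (ha : a.eval w σ = x) (hb : b.eval w σ = y)
    (h : x * y < 2 ^ w) : (Expr.op .mul a b).eval w σ = x * y := by
  rw [Expr.eval, ha, hb]
  exact Nat.mod_eq_of_lt h

theorem eval_lt_ne_zero {a b : Expr} (hw : 1 < 2 ^ w) :
    (Expr.op .lt a b).eval w σ ≠ 0 ↔ a.eval w σ < b.eval w σ := by
  by_cases h : a.eval w σ < b.eval w σ <;> simp [Expr.eval, Op.apply, h, Nat.mod_eq_of_lt hw]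

theorem eval_lt_eq_zero {a b : Expr} (hw : 1 < 2 ^ w) :
    (Expr.op .lt a b).eval w σ = 0 ↔ b.eval w σ ≤ a.eval w σ := by
  rw [← not_lt, ← eval_lt_ne_zero hw, not_not]

theorem eval_eq_ne_zero {a b : Expr} (hw : 1 < 2 ^ w) :
    (Expr.op .eq a b).eval w σ ≠ 0 ↔ a.eval w σ = b.eval w σ := by
  by_cases h : a.eval w σ = b.eval w σ <;> simp [Expr.eval, Op.apply, h, Nat.mod_eq_of_lt hw]

theorem eval_eq_eq_zero {a b : Expr} (hw : 1 < 2 ^ w) :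
    (Expr.op .eq a b).eval w σ = 0 ↔ a.eval w σ ≠ b.eval w σ := by
  have := eval_eq_ne_zero (σ := σ) (a := a) (b := b) hw
  tauto

/-- The rule for counting loops: `I i` is an invariant that does not depend on the counter, which
the body of the loop must not write. -/
theorem WP.forTo {I : ℕ → State → Prop} {x b B K : ℕ} (hw : 1 < 2 ^ w) (hB : B < 2 ^ w)
    (hxb : b ≠ x) (hx : p.modVar x = false) (hb : p.modVar b = false) (hσ : σ.var b = B)
    (hI : ∀ i τ v, I i τ → I i (τ.setVar x v)) (h₀ : I 0 σ)
    (h : ∀ i τ, i < B → (WordRAM.forTo x b p).Frame σ τ → τ.var x = i → I i τ →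
      WP w p τ fun t υ => t ≤ K ∧ I (i + 1) υ) :
    WP w (WordRAM.forTo x b p) σ fun t τ => t ≤ B * (K + 8) + 6 ∧ I B τ := by
  set J : ℕ → State → Prop := fun T τ =>
    ∃ i ≤ B, τ.var x = i ∧ τ.var b = B ∧ (WordRAM.forTo x b p).Frame σ τ ∧ I i τ ∧
      T = (B - i) * (K + 8) + 4 with hJ
  refine WP.seq (WP.assign (v := 0) (by simp [Expr.eval]) ?_)
  have hfr : (WordRAM.forTo x b p).Frame σ (σ.setVar x 0) :=
    (Exec.assign (w := w) σ x (.const 0)).frame |> fun hf =>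
      ⟨fun y hy => by
        simp only [WordRAM.forTo, Program.modVar, Bool.or_eq_false_iff] at hy
        simpa [Expr.eval] using hf.var y hy.1, fun _ _ => rfl⟩
  refine WP.mono (WP.loop (I := J) (T := B * (K + 8) + 4) ?_ ?_ ?_) ?_
  · rintro T τ - ⟨i, hi, hxi, hbB, hF, hIi, rfl⟩ he
    rw [eval_lt_ne_zero hw] at he
    simp only [Expr.eval, hxi, hbB] at he
    refine WP.seq (WP.mono (h i τ he hF hxi hIi) ?_)
    rintro t υ hυ ⟨ht, hI'⟩
    refine WP.assign (v := i + 1) ?_ ?_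
    · simp only [Expr.eval, Op.apply, hυ.var x hx, hxi, Nat.mod_eq_of_lt hw]
      exact Nat.mod_eq_of_lt (by omega)
    · refine ⟨(B - (i + 1)) * (K + 8) + 4, ?_, i + 1, he, by simp, ?_, ?_, hI _ _ _ hI', rfl⟩
      · have : B - i = B - (i + 1) + 1 := by omega
        rw [this, Nat.add_mul]
        simp only [Expr.cost]
        omega
      · rw [setVar_var_ne _ _ hxb, hυ.var b hb, hbB]
      · refine hF.trans ⟨fun y hy => ?_, fun a ha => ?_⟩
        · simp only [WordRAM.forTo, Program.modVar, Bool.or_eq_false_iff, beq_eq_false_iff_ne]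
            at hy
          rw [setVar_var_ne _ _ (Ne.symm hy.1), hυ.var y hy.2.1]
        · simp only [WordRAM.forTo, Program.modArr, Bool.or_eq_false_iff] at ha
          exact hυ.arr a ha.2.1
  · rintro T τ ⟨i, hi, hxi, hbB, hF, hIi, rfl⟩ he
    simp [Expr.cost]
  · exact ⟨0, Nat.zero_le _, by simp, by simp [hxb, hσ], hfr, hI _ _ _ h₀, by simp⟩
  · rintro t τ - ⟨ht, he, T', i, hi, hxi, hbB, hF, hIi, -⟩
    rw [eval_lt_eq_zero hw] at he
    simp only [Expr.eval, hxi, hbB] at he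
    obtain rfl : i = B := by omega
    exact ⟨by simp only [Expr.cost]; omega, hIi⟩

end

/-! ### Breadth-first search, combinatorially -/

/-- `δ` is the distance from `u` in the graph with the adjacency relation `E`, all of whose vertices
that can be reached from `u` form the set `V`. -/
structure DistFrom (E : ℕ → ℕ → Prop) (V : Finset ℕ) (u : ℕ) (δ : ℕ → ℕ) : Prop where
  root : u ∈ V
  closed : ∀ {x y}, x ∈ V → E x y → y ∈ V
  zero : ∀ {x}, x ∈ V → (δ x = 0 ↔ x = u)
  adj : ∀ {x y}, x ∈ V → E x y → δ y ≤ δ x + 1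
  pred : ∀ {y k}, y ∈ V → δ y = k + 1 → ∃ p ∈ V, E p y ∧ δ p = k

/-- `Q` lists, in the order of their distances `δ`, `s` vertices of `V` that are closest possible. -/
structure Closest (V : Finset ℕ) (δ : ℕ → ℕ) (s : ℕ) (Q : ℕ → ℕ) : Prop where
  mem : ∀ {i}, i < s → Q i ∈ V
  inj : ∀ {i j}, i < s → j < s → Q i = Q j → i = j
  mono : ∀ {i j}, i ≤ j → j < s → δ (Q i) ≤ δ (Q j)
  complete : ∀ {y}, y ∈ V → ∀ {j}, j < s → δ y < δ (Q j) → ∃ i < s, Q i = y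

/-- The invariant of breadth-first search from `u`: the queue `Q` holds the `tail` vertices that
have been discovered, the first `head` of which have been processed; the label `dist` is `0` at
vertices that have not been discovered, and exceeds the distance by one at the others. -/
structure BFSInv (E : ℕ → ℕ → Prop) (V : Finset ℕ) (u : ℕ) (δ : ℕ → ℕ) (head tail : ℕ)
    (Q dist : ℕ → ℕ) : Prop extends Closest V δ tail Q where
  head_le : head ≤ tail
  root : ∃ i < tail, Q i = u
  val : ∀ {i}, i < tail → dist (Q i) = δ (Q i) + 1
  disc : ∀ {y}, y ∈ V → dist y ≠ 0 → ∃ i < tail, Q i = y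
  processed : ∀ {i}, i < head → ∀ {y}, E (Q i) y → ∃ j < tail, Q j = y
  near : ∀ {i j}, i < tail → head ≤ j → j < tail → δ (Q i) ≤ δ (Q j) + 1

section

variable {E : ℕ → ℕ → Prop} {V : Finset ℕ} {u : ℕ} {δ : ℕ → ℕ} {s head tail : ℕ} {Q dist : ℕ → ℕ}

theorem DistFrom.lt_card (h : DistFrom E V u δ) {x : ℕ} (hx : x ∈ V) : δ x < V.card := by
  -- every value up to `δ x` is taken on `V`
  have key : ∀ k, ∀ y ∈ V, δ y = k → Finset.range (k + 1) ⊆ V.image δ := by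
    intro k
    induction k with
    | zero =>
      intro y hy h0 i hi
      obtain rfl : i = 0 := by simpa using hi
      exact Finset.mem_image.2 ⟨y, hy, h0⟩
    | succ k ih =>
      intro y hy hk
      rw [Finset.range_add_one, Finset.insert_subset_iff]
      obtain ⟨p, hp, -, hpk⟩ := h.pred hy hk
      exact ⟨Finset.mem_image.2 ⟨y, hy, hk⟩, ih p hp hpk⟩
  have := (Finset.card_le_card (key _ x hx rfl)).trans Finset.card_image_le
  simpa using this

theorem Closest.le (h : Closest V δ tail Q) (hs : s ≤ tail) : Closest V δ s Q where
  mem hi := h.mem (hi.trans_le hs)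
  inj hi hj := h.inj (hi.trans_le hs) (hj.trans_le hs)
  mono hij hj := h.mono hij (hj.trans_le hs)
  complete {y} hy {j} hj hlt := by
    obtain ⟨i, hi, rfl⟩ := h.complete hy (hj.trans_le hs) hlt
    refine ⟨i, ?_, rfl⟩
    by_contra hc
    exact absurd (h.mono (i := j) (j := i) (by omega) hi) (by omega)

theorem Closest.congr {Q' : ℕ → ℕ} (h : Closest V δ s Q) (hQ : ∀ i < s, Q' i = Q i) :
    Closest V δ s Q' where
  mem {i} hi := (hQ i hi).symm ▸ h.mem hi
  inj {i j} hi hj hij := h.inj hi hj (by rw [← hQ i hi, hij, hQ j hj])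
  mono {i j} hij hj := by
    rw [hQ i (hij.trans_lt hj), hQ j hj]
    exact h.mono hij hj
  complete {y} hy {j} hj hlt := by
    rw [hQ j hj] at hlt
    obtain ⟨i, hi, rfl⟩ := h.complete hy hj hlt
    exact ⟨i, hi, hQ i hi⟩

theorem BFSInv.init (h : DistFrom E V u δ) (h0 : Q 0 = u) (hd : ∀ y ∈ V, dist y ≠ 0 → y = u)
    (hu : dist u = 1) : BFSInv E V u δ 0 1 Q dist where
  mem {i} hi := by obtain rfl : i = 0 := by omega
                   exact h0 ▸ h.root
  inj := by omega
  mono {i j} hij hj := by obtain rfl : i = j := by omega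
                          exact le_rfl
  complete {y} hy {j} hj hlt := by
    obtain rfl : j = 0 := by omega
    rw [h0, (h.zero h.root).2 rfl] at hlt
    omega
  head_le := Nat.zero_le _
  root := ⟨0, one_pos, h0⟩
  val {i} hi := by
    obtain rfl : i = 0 := by omega
    rw [h0, hu, (h.zero h.root).2 rfl]
  disc hy hne := ⟨0, one_pos, by rw [h0, hd _ hy hne]⟩
  processed := by omega
  near {i j} hi _ hj := by obtain rfl : i = j := by omega
                           omega

/-- Every vertex that is no farther than the next vertex of the queue has been discovered. -/
theorem BFSInv.discovered (h : DistFrom E V u δ) (hI : BFSInv E V u δ head tail Q dist)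
    (hlt : head < tail) {z : ℕ} (hz : z ∈ V) (hle : δ z ≤ δ (Q head)) : ∃ i < tail, Q i = z := by
  rcases Nat.eq_zero_or_eq_succ_pred (δ z) with h0 | h1
  · rw [(h.zero hz).1 h0]
    exact hI.root
  · obtain ⟨p, hp, hpz, hpk⟩ := h.pred hz h1
    obtain ⟨i, hi, rfl⟩ := hI.complete hp hlt (by simp only [Nat.pred_eq_sub_one] at *; omega)
    refine hI.processed (i := i) ?_ hpz
    by_contra hc
    have := hI.mono (i := head) (j := i) (by omega) hi
    simp only [Nat.pred_eq_sub_one] at *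
    omega

/-- Discovering a neighbour of the next vertex of the queue preserves the invariant. -/
theorem BFSInv.push (h : DistFrom E V u δ) (hI : BFSInv E V u δ head tail Q dist)
    (hlt : head < tail) {y : ℕ} (hE : E (Q head) y) (hy : dist y = 0) :
    BFSInv E V u δ head (tail + 1) (Function.update Q tail y)
      (Function.update dist y (dist (Q head) + 1)) := by
  have hQ : ∀ {i}, i < tail → Function.update Q tail y i = Q i := fun {i} hi =>
    Function.update_of_ne (by omega) _ _
  have hT : Function.update Q tail y tail = y := Function.update_self _ _ _
  have hyV : y ∈ V := h.closed (hI.mem hlt) hE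
  have hne : ∀ {i}, i < tail → Q i ≠ y := by
    rintro i hi rfl
    have := hI.val hi
    omega
  have hδ : δ y = δ (Q head) + 1 := by
    refine le_antisymm (h.adj (hI.mem hlt) hE) (Nat.succ_le_of_lt ?_)
    by_contra hc
    obtain ⟨i, hi, hiy⟩ := hI.discovered h hlt hyV (not_lt.1 hc)
    exact hne hi hiy
  have cases : ∀ {i}, i < tail + 1 → i < tail ∨ i = tail := by omega
  have lift : ∀ {z}, (∃ i < tail, Q i = z) → ∃ i < tail + 1, Function.update Q tail y i = z := by
    rintro z ⟨i, hi, rfl⟩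
    exact ⟨i, by omega, hQ hi⟩
  refine { mem := ?_, inj := ?_, mono := ?_, complete := ?_, head_le := hI.head_le.trans (by omega),
           root := lift hI.root, val := ?_, disc := ?_, processed := ?_, near := ?_ }
  · intro i hi
    rcases cases hi with hi | rfl
    · exact hQ hi ▸ hI.mem hi
    · exact hT.symm ▸ hyV
  · intro i j hi hj hij
    rcases cases hi with hi | rfl <;> rcases cases hj with hj | rfl
    · rw [hQ hi, hQ hj] at hij
      exact hI.inj hi hj hij
    · rw [hQ hi, hT] at hij
      exact absurd hij (hne hi)
    · rw [hQ hj, hT] at hij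
      exact absurd hij.symm (hne hj)
    · rfl
  · intro i j hij hj
    rcases cases hj with hj | rfl
    · rw [hQ hj, hQ (by omega)]
      exact hI.mono hij hj
    · rw [hT, hδ]
      rcases cases (i := i) (by omega) with hi | rfl
      · rw [hQ hi]
        exact hI.near hi le_rfl hlt
      · rw [hT, hδ]
  · intro z hz j hj hlt'
    rcases cases hj with hj | rfl
    · rw [hQ hj] at hlt'
      exact lift (hI.complete hz hj hlt')
    · rw [hT, hδ] at hlt'
      exact lift (hI.discovered h hlt hz (by omega))
  · intro i hi
    rcases cases hi with hi | rfl
    · rw [hQ hi, Function.update_of_ne (hne hi), hI.val hi]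
    · rw [hT, Function.update_self, hI.val hlt, hδ]
  · intro z hz hne'
    by_cases hzy : z = y
    · exact ⟨tail, by omega, by rw [hT, hzy]⟩
    · rw [Function.update_of_ne hzy] at hne'
      exact lift (hI.disc hz hne')
  · intro i hi z hE'
    rw [hQ (hi.trans hlt)] at hE'
    exact lift (hI.processed hi hE')
  · intro i j hi hj hj'
    rcases cases hi with hi | rfl <;> rcases cases hj' with hj' | rfl
    · rw [hQ hi, hQ hj']
      exact hI.near hi hj hj'
    · rw [hQ hi, hT, hδ]
      exact (hI.near hi le_rfl hlt).trans (by omega)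
    · rw [hQ hj', hT, hδ]
      have := hI.mono hj hj'
      omega
    · omega

/-- Once all its neighbours have been discovered, the next vertex of the queue has been
processed. -/
theorem BFSInv.pop (hI : BFSInv E V u δ head tail Q dist) (hlt : head < tail)
    (hx : ∀ y, E (Q head) y → ∃ j < tail, Q j = y) :
    BFSInv E V u δ (head + 1) tail Q dist :=
  { hI with
    head_le := hlt
    processed := by
      intro i hi y hE
      rcases Nat.lt_succ_iff_lt_or_eq.1 hi with hi | rfl
      · exact hI.processed hi hE
      · exact hx y hE
    near := fun hi hj hj' => hI.near hi (by omega) hj' }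

/-- The queue does not become empty before all of `V` has been discovered. -/
theorem BFSInv.head_lt (h : DistFrom E V u δ) (hI : BFSInv E V u δ head tail Q dist)
    (hc : tail < V.card) : head < tail := by
  by_contra hcon
  obtain rfl : head = tail := le_antisymm hI.head_le (not_lt.1 hcon)
  have key : ∀ k, ∀ y ∈ V, δ y = k → ∃ i < head, Q i = y := by
    intro k
    induction k with
    | zero =>
      intro y hy h0
      rw [(h.zero hy).1 h0]
      exact hI.root
    | succ k ih =>
      intro y hy hk
      obtain ⟨p, hp, hE, hpk⟩ := h.pred hy hk
      obtain ⟨i, hi, rfl⟩ := ih p hp hpk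
      exact hI.processed hi hE
  have : V ⊆ (Finset.range head).image Q := by
    intro y hy
    obtain ⟨i, hi, hiy⟩ := key _ y hy rfl
    exact Finset.mem_image.2 ⟨i, Finset.mem_range.2 hi, hiy⟩
  have := (Finset.card_le_card this).trans Finset.card_image_le
  rw [Finset.card_range] at this
  omega

end

/-! ### The memory of the algorithm -/

-- Shorthands for expressions and programs.
local infixl:65 " ⊞ " => Expr.op Op.add
local infixl:65 " ⊟ " => Expr.op Op.sub
local infixl:70 " ⊠ " => Expr.op Op.mul
local infix:50 " ≺ " => Expr.op Op.lt
local infix:50 " ≐ " => Expr.op Op.eq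
local infixr:30 " ;; " => Program.seq
local infix:40 " ::= " => Program.assign

-- Variables: the numbers of vertices and of arcs, their doubles, and the size of the balls.
local notation "vn" => 0
local notation "vm" => 1
local notation "vN" => 2
local notation "vM" => 3
local notation "vs" => 4
-- Loop counters.
local notation "va" => 5
local notation "vb" => 6
local notation "vi" => 7
local notation "vj" => 8
-- Breadth-first search: the root, the number of vertices to be found, the two ends of the queue,
-- the vertices at the two ends of an arc, and a pointer to an arc.
local notation "vRoot" => 9
local notation "vCap" => 10
local notation "vHead" => 11
local notation "vTail" => 12
local notation "vx" => 13
local notation "vy" => 14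
local notation "vp" => 15
-- The vertex chosen in a greedy round, and whether to go on.
local notation "vMax" => 16
local notation "vGo" => 17
-- The best lower bound so far, the bound from a pair of balls, a vertex of the reversed copy (or an
-- eccentricity), and the length of a path.
local notation "vBest" => 18
local notation "vEst" => 19
local notation "vz" => 20
local notation "vCand" => 21

-- Arrays: the ends of the arcs, the linked lists of arcs, and the adjacency matrix.
local notation "aTail" => 0
local notation "aTip" => 1
local notation "aFirst" => 2
local notation "aNext" => 3
local notation "aAdj" => 4
-- The labels and the queue of breadth-first search.
local notation "aDist" => 5
local notation "aQueue" => 6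
-- The balls, and the distances of their entries.
local notation "aBall" => 7
local notation "aRad" => 8
-- How many balls contain a vertex, and which balls have been hit.
local notation "aCount" => 9
local notation "aHit" => 10

/-! ### Breadth-first search on the machine -/

/-- Process the arc of index `vp - 1`, which leaves `vx`. -/
def scan : Program :=
  vy ::= .read aTip (.var vp ⊟ .const 1) ;;
  .ite (.read aDist (.var vy) ≐ .const 0)
    (.store aDist (.var vy) (.read aDist (.var vx) ⊞ .const 1) ;;
     .store aQueue (.var vTail) (.var vy) ;;
     vTail ::= .var vTail ⊞ .const 1)
    .skip ;;
  vp ::= .read aNext (.var vp ⊟ .const 1)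

/-- Process the next vertex of the queue. -/
def visit : Program :=
  vx ::= .read aQueue (.var vHead) ;;
  vHead ::= .var vHead ⊞ .const 1 ;;
  vp ::= .read aFirst (.var vx) ;;
  .loop (.var vp) scan

/-- Breadth-first search from `vRoot`, until at least `vCap` vertices have been discovered. -/
def bfs : Program :=
  forTo vi vN (.store aDist (.var vi) (.const 0)) ;;
  .store aDist (.var vRoot) (.const 1) ;;
  .store aQueue (.const 0) (.var vRoot) ;;
  vHead ::= .const 0 ;;
  vTail ::= .const 1 ;;
  .loop (.var vTail ≺ .var vCap) visit

/-- The pointer `k` is the start of a linked list of the indices `l`. A pointer is `0` at the end of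
a list, and exceeds the index to which it points by one elsewhere. -/
inductive Links (next : ℕ → ℕ) : ℕ → List ℕ → Prop
  | nil : Links next 0 []
  | cons {p : ℕ} {l : List ℕ} (h : Links next (next p) l) : Links next (p + 1) (p :: l)

/-- The linked lists in `σ` represent the arcs of `E` that leave the vertices in `V`. The word
length is `w`, and the vertex `x` has out-degree `deg x`. -/
def Represents (w : ℕ) (σ : State) (E : ℕ → ℕ → Prop) (V : Finset ℕ) (deg : ℕ → ℕ) : Prop :=
  ∀ x ∈ V, ∃ l, Links (σ.arr aNext) (σ.arr aFirst x) l ∧ l.length = deg x ∧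
    (∀ p ∈ l, p + 1 < 2 ^ w) ∧ ∀ y, E x y ↔ ∃ p ∈ l, σ.arr aTip p = y

section

variable {w : ℕ} {E : ℕ → ℕ → Prop} {V : Finset ℕ} {u : ℕ} {δ : ℕ → ℕ} {deg : ℕ → ℕ}

theorem Closest.tail_le {s : ℕ} {Q : ℕ → ℕ} (h : Closest V δ s Q) : s ≤ V.card := by
  have := Finset.card_le_card_of_injOn (s := Finset.range s) (t := V) Q
    (fun i hi => h.mem (Finset.mem_range.1 hi))
    (fun i hi j hj hij => h.inj (by simpa using hi) (by simpa using hj) hij)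
  simpa using this

/-- Scanning the list of arcs that leave the next vertex of the queue processes this vertex. -/
theorem wp_scan_loop {σ : State} {head : ℕ} (hw : 1 < 2 ^ w) (hV : V.card + 2 < 2 ^ w)
    (hD : DistFrom E V u δ) {l : List ℕ} (hl : Links (σ.arr aNext) (σ.var vp) l)
    (hlw : ∀ p ∈ l, p + 1 < 2 ^ w) (hlE : ∀ y, E (σ.var vx) y ↔ ∃ p ∈ l, σ.arr aTip p = y)
    (hI : BFSInv E V u δ head (σ.var vTail) (σ.arr aQueue) (σ.arr aDist))
    (hh : head < σ.var vTail) (hx : σ.arr aQueue head = σ.var vx) :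
    WP w (.loop (.var vp) scan) σ fun t τ => t ≤ l.length * 40 + 2 ∧
      BFSInv E V u δ (head + 1) (τ.var vTail) (τ.arr aQueue) (τ.arr aDist) ∧
      ∀ i ≤ head, τ.arr aQueue i = σ.arr aQueue i := by
  refine WP.mono (WP.loop (I := fun T τ => ∃ l', Links (σ.arr aNext) (τ.var vp) l' ∧
    (∀ p ∈ l', p ∈ l) ∧
    BFSInv E V u δ head (τ.var vTail) (τ.arr aQueue) (τ.arr aDist) ∧ head < τ.var vTail ∧
    (∀ i ≤ head, τ.arr aQueue i = σ.arr aQueue i) ∧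
    (∀ y, E (σ.var vx) y →
      (∃ j < τ.var vTail, τ.arr aQueue j = y) ∨ ∃ p ∈ l', σ.arr aTip p = y) ∧
    T = l'.length * 40 + 2) (T := l.length * 40 + 2) ?_ ?_ ?_) ?_
  · rintro T τ hF ⟨l', hl', hsub, hI, hlt, hold, hrest, rfl⟩ he
    simp only [Expr.eval] at he
    have hT : τ.arr aTip = σ.arr aTip := hF.arr aTip rfl
    have hN : τ.arr aNext = σ.arr aNext := hF.arr aNext rfl
    have hX : τ.var vx = σ.var vx := hF.var vx rfl
    generalize hpv : τ.var vp = pv at hl' he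
    cases hl' with
    | nil => exact absurd rfl he
    | @cons p l' hl' =>
    have hpw := hlw p (hsub p (by simp))
    have hev : ∀ τ' : State, τ'.var vp = p + 1 → (Expr.var vp ⊟ .const 1).eval w τ' = p :=
      fun τ' h => eval_sub (x := p + 1) (eval_var h) (eval_const hw) hpw
    have hE : E (σ.var vx) (σ.arr aTip p) := (hlE _).2 ⟨p, hsub p (by simp), rfl⟩
    have hQh : τ.arr aQueue head = σ.var vx := by rw [hold head le_rfl, hx]
    have hcard := hI.tail_le
    have hdx : τ.arr aDist (σ.var vx) = δ (σ.var vx) + 1 := hQh ▸ hI.val hlt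
    have hδ : δ (σ.var vx) < V.card := hD.lt_card (hQh ▸ hI.mem hlt)
    refine WP.seq (WP.assign (v := σ.arr aTip p) (eval_read (hev τ hpv) (by rw [hT])) ?_)
    refine WP.seq (WP.ite (fun he => ?_) (fun he => ?_))
    · rw [eval_eq_ne_zero hw, eval_const (by omega)] at he
      have hy : τ.arr aDist (σ.arr aTip p) = 0 := by simpa [Expr.eval] using he
      have hI' := hI.push hD hlt (y := σ.arr aTip p) (by rw [hQh]; exact hE) hy
      refine WP.seq (WP.store (j := σ.arr aTip p) (v := δ (σ.var vx) + 1 + 1)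
        (by simp [Expr.eval])
        (eval_add (eval_read (j := σ.var vx) (by simp [Expr.eval, hX]) (by simp [hdx]))
          (eval_const hw) (by omega)) ?_)
      refine WP.seq (WP.store (j := τ.var vTail) (v := σ.arr aTip p)
        (by simp [Expr.eval]) (by simp [Expr.eval]) ?_)
      refine WP.assign (v := τ.var vTail + 1)
        (eval_add (by simp [Expr.eval]) (eval_const hw) (by omega)) ?_
      refine WP.assign (v := σ.arr aNext p)
        (eval_read (j := p) (hev _ (by simpa using hpv)) (by simp [hN])) ?_
      refine ⟨l'.length * 40 + 2, by simp [Expr.cost]; omega, l', by simpa using hl',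
        fun q hq => hsub q (by simp [hq]), ?_, by simp; omega, ?_, ?_, rfl⟩
      · rw [hQh, hdx] at hI'
        simpa using hI'
      · intro i hi
        have : i ≠ τ.var vTail := by omega
        simp [this, hold i hi]
      · intro y hy
        rcases hrest y hy with ⟨j, hj, rfl⟩ | ⟨q, hq, rfl⟩
        · have : j ≠ τ.var vTail := by omega
          exact .inl ⟨j, by simp; omega, by simp [this]⟩
        · rcases List.mem_cons.1 hq with rfl | hq
          · exact .inl ⟨τ.var vTail, by simp, by simp⟩
          · exact .inr ⟨q, hq, rfl⟩
    · rw [eval_eq_eq_zero hw, eval_const (by omega)] at he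
      have hy : τ.arr aDist (σ.arr aTip p) ≠ 0 := by simpa [Expr.eval] using he
      refine WP.skip (WP.assign (v := σ.arr aNext p)
        (eval_read (j := p) (hev _ (by simpa using hpv)) (by simp [hN])) ?_)
      refine ⟨l'.length * 40 + 2, by simp [Expr.cost]; omega, l', by simpa using hl',
        fun q hq => hsub q (by simp [hq]), by simpa using hI, by simpa using hlt,
        by simpa using hold, ?_, rfl⟩
      intro y hy'
      rcases hrest y hy' with h | ⟨q, hq, rfl⟩
      · exact .inl (by simpa using h)
      · rcases List.mem_cons.1 hq with rfl | hq
        · exact .inl (by simpa using hI.disc (hD.closed (hQh ▸ hI.mem hlt) hE) hy)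
        · exact .inr ⟨q, hq, rfl⟩
  · rintro T τ ⟨l', hl', hsub, hI, hlt, hold, hrest, rfl⟩ he
    simp [Expr.cost]
  · exact ⟨l, hl, fun _ h => h, hI, hh, fun _ _ => rfl, fun y hy => .inr ((hlE y).1 hy), rfl⟩
  · rintro t τ - ⟨ht, he, T, l', hl', hsub, hI, hlt, hold, hrest, rfl⟩
    simp only [Expr.eval] at he
    rw [he] at hl'
    cases hl'
    refine ⟨ht, hI.pop hlt fun y hy => ?_, hold⟩
    rw [hold head le_rfl, hx] at hy
    simpa using hrest y hy

/-- The main loop of breadth-first search. The time credits of the invariant pay for the vertices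
that are still to be processed, according to their degrees. -/
theorem wp_visit_loop {σ : State} {cap W : ℕ} (hw : 1 < 2 ^ w) (hV : V.card + 2 < 2 ^ w)
    (hD : DistFrom E V u δ) (hR : Represents w σ E V deg) (hcap : σ.var vCap = cap)
    (hcapV : cap ≤ V.card) (hW : ∀ S ⊆ V, S.card ≤ cap → ∑ x ∈ S, deg x ≤ W)
    (hhead : σ.var vHead = 0)
    (hI : BFSInv E V u δ 0 (σ.var vTail) (σ.arr aQueue) (σ.arr aDist)) :
    WP w (.loop (.var vTail ≺ .var vCap) visit) σ fun t τ => t ≤ cap * 20 + W * 40 + 4 ∧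
      Closest V δ cap (τ.arr aQueue) ∧
      ∀ i < cap, τ.arr aDist (τ.arr aQueue i) = δ (τ.arr aQueue i) + 1 := by
  have hsum : ∀ {head tail : ℕ} {Q dist : ℕ → ℕ}, BFSInv E V u δ head tail Q dist →
      head ≤ cap → ∑ i ∈ Finset.range head, deg (Q i) ≤ W := by
    intro head tail Q dist hI hle
    have hlt : ∀ i ∈ Finset.range head, i < tail := fun i hi =>
      (Finset.mem_range.1 hi).trans_le hI.head_le
    have hinj : Set.InjOn Q (Finset.range head : Set ℕ) := fun i hi j hj hij =>
      hI.inj (hlt i (by simpa using hi)) (hlt j (by simpa using hj)) hij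
    rw [← Finset.sum_image (f := deg) hinj]
    refine hW _ (fun x hx => ?_) ((Finset.card_image_le).trans (by simpa using hle))
    obtain ⟨i, hi, rfl⟩ := Finset.mem_image.1 hx
    exact hI.mem (hlt i hi)
  refine WP.mono (WP.loop (I := fun T τ => ∃ head ≤ cap, τ.var vHead = head ∧
    BFSInv E V u δ head (τ.var vTail) (τ.arr aQueue) (τ.arr aDist) ∧
    T = (cap - head) * 20 + (W - ∑ i ∈ Finset.range head, deg (τ.arr aQueue i)) * 40 + 4)
    (T := cap * 20 + W * 40 + 4) ?_ ?_ ?_) ?_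
  · rintro T τ hF ⟨head, hle, hvh, hI, rfl⟩ he
    have hC : τ.var vCap = cap := (hF.var vCap rfl).trans hcap
    rw [eval_lt_ne_zero hw] at he
    replace he : τ.var vTail < cap := by simpa [Expr.eval, hC] using he
    have hlt := hI.head_lt hD (he.trans_le hcapV)
    obtain ⟨l, hl, hlen, hlw, hlE⟩ := hR _ (hI.mem hlt)
    refine WP.seq (WP.assign (v := τ.arr aQueue head) (eval_read hvh rfl) ?_)
    refine WP.seq (WP.assign (v := head + 1)
      (eval_add (by simpa [Expr.eval] using hvh) (eval_const hw) (by omega)) ?_)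
    refine WP.seq (WP.assign (v := σ.arr aFirst (τ.arr aQueue head))
      (eval_read (j := τ.arr aQueue head) (by simp [Expr.eval])
        (by simp [hF.arr aFirst rfl])) ?_)
    refine WP.mono (wp_scan_loop hw hV hD (head := head) (l := l) ?_ hlw ?_ ?_ ?_ ?_) ?_
    · simpa [hF.arr aNext rfl] using hl
    · simpa [hF.arr aTip rfl] using hlE
    · simpa using hI
    · simpa using hlt
    · simp
    · rintro t υ hυ ⟨ht, hI', hQ⟩
      have hvh' : υ.var vHead = head + 1 := by rw [hυ.var vHead rfl]; simp
      have hs := hsum hI' (by omega)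
      have heq : ∑ i ∈ Finset.range (head + 1), deg (υ.arr aQueue i) =
          ∑ i ∈ Finset.range (head + 1), deg (τ.arr aQueue i) := by
        refine Finset.sum_congr rfl fun i hi => ?_
        rw [hQ i (by simpa [Nat.lt_succ_iff] using hi)]
        simp
      refine ⟨_, ?_, head + 1, by omega, hvh', hI', rfl⟩
      rw [heq] at hs ⊢
      rw [Finset.sum_range_succ] at hs ⊢
      simp only [Expr.cost]
      omega
  · rintro T τ ⟨head, hle, hvh, hI, rfl⟩ he
    simp [Expr.cost]
  · exact ⟨0, Nat.zero_le _, hhead, hI, by simp⟩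
  · rintro t τ hF ⟨ht, he, T, head, hle, hvh, hI, rfl⟩
    have hC : τ.var vCap = cap := (hF.var vCap rfl).trans hcap
    rw [eval_lt_eq_zero hw] at he
    replace he : cap ≤ τ.var vTail := by simpa [Expr.eval, hC] using he
    exact ⟨ht, hI.toClosest.le he, fun i hi => hI.val (hi.trans_le he)⟩

/-- Breadth-first search finds the `cap` vertices that are closest to the root. Its time is governed
by `W`, a bound for the sum of the degrees of any `cap` vertices: only so many are processed. -/
theorem wp_bfs {σ : State} {N cap W : ℕ} (hw : 1 < 2 ^ w) (hN : N + 2 < 2 ^ w)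
    (hVN : ∀ x ∈ V, x < N) (hD : DistFrom E V u δ) (hR : Represents w σ E V deg)
    (hvN : σ.var vN = N) (hroot : σ.var vRoot = u) (hcap : σ.var vCap = cap)
    (hcapV : cap ≤ V.card) (hW : ∀ S ⊆ V, S.card ≤ cap → ∑ x ∈ S, deg x ≤ W) :
    WP w bfs σ fun t τ => t ≤ N * 40 + W * 40 + 40 ∧ Closest V δ cap (τ.arr aQueue) ∧
      ∀ i < cap, τ.arr aDist (τ.arr aQueue i) = δ (τ.arr aQueue i) + 1 := by
  have hVc : V.card ≤ N := by
    simpa using Finset.card_le_card (t := Finset.range N) fun x hx => by simpa using hVN x hx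
  refine WP.seq (WP.mono (WP.forTo (I := fun i τ => ∀ y < i, τ.arr aDist y = 0) (K := 5) hw
    (by omega) (by decide) rfl rfl hvN (fun _ _ _ h => h) (by simp) ?_) ?_)
  · intro i τ hi hF hx hI
    refine WP.store (j := i) (v := 0) hx (eval_const (by omega)) ⟨by simp [Expr.cost], ?_⟩
    intro y hy
    by_cases hyi : y = i
    · simp [hyi]
    · simpa [hyi] using hI y (by omega)
  rintro t τ hF ⟨ht, hI⟩
  have hru : τ.var vRoot = u := (hF.var vRoot rfl).trans hroot
  refine WP.seq (WP.store (j := u) (v := 1) hru (eval_const hw) ?_)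
  refine WP.seq (WP.store (j := 0) (v := u) (eval_const (by omega)) (by simpa [Expr.eval]) ?_)
  refine WP.seq (WP.assign (v := 0) (eval_const (by omega)) ?_)
  refine WP.seq (WP.assign (v := 1) (eval_const hw) ?_)
  refine WP.mono (wp_visit_loop (cap := cap) hw (by omega) hD (deg := deg) ?_ ?_ hcapV hW (by simp)
    ?_) ?_
  · intro x hx
    have h₁ := hF.arr aNext rfl
    have h₂ := hF.arr aFirst rfl
    have h₃ := hF.arr aTip rfl
    simpa [h₁, h₂, h₃] using hR x hx
  · simpa [hcap] using hF.var vCap rfl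
  · refine BFSInv.init hD (by simp) (fun y hy hne => ?_) (by simp)
    by_contra hc
    simp [hc, hI y (hVN y hy)] at hne
  · rintro t' υ hυ ⟨ht', h⟩
    refine ⟨?_, h⟩
    simp only [Expr.cost]
    omega

end

/-! ### Preparing the input -/

/-- The largest `s ≥ 1` with `s ^ 3 * n ≤ m`, or `1` if there is none. -/
def findSize : Program :=
  vs ::= .const 1 ;;
  .loop ((.var vs ⊞ .const 1) ⊠ (.var vs ⊞ .const 1) ⊠ (.var vs ⊞ .const 1) ⊠ .var vn ≺
      .var vm ⊞ .const 1)
    (vs ::= .var vs ⊞ .const 1)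

/-- Append to the arcs on the vertices below `n` their reversals, on the vertices from `n` on, and
record the adjacency matrix of the original graph. -/
def double : Program :=
  forTo vi vm
    (.store aTail (.var vm ⊞ .var vi) (.var vn ⊞ .read aTip (.var vi)) ;;
     .store aTip (.var vm ⊞ .var vi) (.var vn ⊞ .read aTail (.var vi)) ;;
     .store aAdj (.read aTail (.var vi) ⊠ .var vn ⊞ .read aTip (.var vi)) (.const 1))

/-- Build, for every vertex, the linked list of the arcs that leave it. -/
def link : Program :=
  forTo vi vM
    (.store aNext (.var vi) (.read aFirst (.read aTail (.var vi))) ;;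
     .store aFirst (.read aTail (.var vi)) (.var vi ⊞ .const 1))

/-- The tail of the arc `i` of the doubled graph. -/
def dblTail (n m : ℕ) (tl hd : ℕ → ℕ) (i : ℕ) : ℕ := if i < m then tl i else n + hd (i - m)

/-- The head of the arc `i` of the doubled graph. -/
def dblTip (n m : ℕ) (tl hd : ℕ → ℕ) (i : ℕ) : ℕ := if i < m then hd i else n + tl (i - m)

section

variable {w n m : ℕ} {σ : State} {tl hd : ℕ → ℕ}

/-- The loop ends within `n` rounds, as `s ^ 3 * n ≤ m ≤ n ^ 2` implies `s ≤ n`. -/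
theorem wp_findSize (hn : 0 < n) (hm : m ≤ n * n) (hw : (n + 2) ^ 4 ≤ 2 ^ w) (hvn : σ.var vn = n)
    (hvm : σ.var vm = m) :
    WP w findSize σ fun t τ => t ≤ n * 30 + 30 ∧ 1 ≤ τ.var vs ∧ τ.var vs ≤ n ∧
      (τ.var vs = 1 ∨ τ.var vs ^ 3 * n ≤ m) ∧ m < (τ.var vs + 1) ^ 3 * n := by
  have hw4 : (n + 1) * (n + 1) * (n + 1) * n < 2 ^ w := by
    refine lt_of_lt_of_le ?_ hw
    nlinarith [sq_nonneg n, Nat.zero_le (n ^ 3)]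
  have hw3 : (n + 1) * (n + 1) * (n + 1) < 2 ^ w :=
    (Nat.le_mul_of_pos_right _ hn).trans_lt hw4
  have hw2 : (n + 1) * (n + 1) < 2 ^ w := (Nat.le_mul_of_pos_right _ (by omega)).trans_lt hw3
  have hw1 : n + 1 < 2 ^ w := (Nat.le_mul_of_pos_right _ (by omega)).trans_lt hw2
  have key : ∀ τ : State, τ.var vn = n → τ.var vm = m → τ.var vs ≤ n →
      ((((.var vs ⊞ .const 1) ⊠ (.var vs ⊞ .const 1) ⊠ (.var vs ⊞ .const 1) ⊠ .var vn ≺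
      .var vm ⊞ .const 1 : Expr).eval w τ ≠ 0) ↔ (τ.var vs + 1) ^ 3 * n ≤ m) := by
    intro τ hvn hvm hs
    have h₁ : (.var vs ⊞ .const 1 : Expr).eval w τ = τ.var vs + 1 :=
      eval_add (eval_var rfl) (eval_const (by omega)) (by omega)
    have hs' : τ.var vs + 1 ≤ n + 1 := by omega
    generalize τ.var vs = s at *
    have b2 : (s + 1) * (s + 1) ≤ (n + 1) * (n + 1) := Nat.mul_le_mul hs' hs'
    have b3 := Nat.mul_le_mul b2 hs'
    have b4 := Nat.mul_le_mul_right n b3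
    rw [eval_lt_ne_zero (by omega), eval_mul (eval_mul (eval_mul h₁ h₁ (b2.trans_lt hw2)) h₁
      (b3.trans_lt hw3)) (eval_var hvn) (b4.trans_lt hw4),
      eval_add (eval_var hvm) (eval_const (by omega)) (by nlinarith), Nat.lt_succ_iff, pow_succ,
      pow_two]
  refine WP.seq (WP.assign (v := 1) (eval_const (by omega)) ?_)
  refine WP.mono (WP.loop (I := fun T τ => 1 ≤ τ.var vs ∧ τ.var vs ≤ n ∧
    (τ.var vs = 1 ∨ τ.var vs ^ 3 * n ≤ m) ∧ T = (n - τ.var vs) * 30 + 18) (T := (n - 1) * 30 + 18)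
    ?_ ?_ ?_) ?_
  · rintro T τ hF ⟨h1, hn', h, rfl⟩ he
    have hvn' : τ.var vn = n := (hF.var vn rfl).trans (by simpa using hvn)
    have hvm' : τ.var vm = m := (hF.var vm rfl).trans (by simpa using hvm)
    rw [key τ hvn' hvm' hn'] at he
    refine WP.assign (v := τ.var vs + 1)
      (eval_add (eval_var rfl) (eval_const (by omega)) (by omega)) ?_
    have hlt : τ.var vs + 1 ≤ n := by
      have : (τ.var vs + 1) ^ 3 ≤ n := Nat.le_of_mul_le_mul_right (he.trans hm) hn
      exact (Nat.le_self_pow (by decide) _).trans this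
    refine ⟨_, ?_, by simp, by simpa using hlt, .inr (by simpa using he), rfl⟩
    simp only [Expr.cost, setVar_var_self]
    omega
  · rintro T τ ⟨h1, hn', h, rfl⟩ he
    simp [Expr.cost]
  · exact ⟨by simp, by simp; omega, .inl (by simp), by simp⟩
  · rintro t τ hF ⟨ht, he, T, h1, hn', h, rfl⟩
    have hvn' : τ.var vn = n := (hF.var vn rfl).trans (by simpa using hvn)
    have hvm' : τ.var vm = m := (hF.var vm rfl).trans (by simpa using hvm)
    have := (key τ hvn' hvm' hn').not.1 (not_not.2 he)
    refine ⟨?_, h1, hn', h, not_le.1 this⟩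
    simp only [Expr.cost]
    omega

theorem wp_double (hw : (n + 2) ^ 4 ≤ 2 ^ w) (hm : m ≤ n * n) (hvn : σ.var vn = n)
    (hvm : σ.var vm = m) (htl : ∀ i < m, σ.arr aTail i = tl i) (hhd : ∀ i < m, σ.arr aTip i = hd i)
    (htn : ∀ i < m, tl i < n) (hhn : ∀ i < m, hd i < n) (hadj : σ.arr aAdj = fun _ => 0) :
    WP w double σ fun t τ => t ≤ m * 40 + 6 ∧
      (∀ i < m + m, τ.arr aTail i = dblTail n m tl hd i) ∧
      (∀ i < m + m, τ.arr aTip i = dblTip n m tl hd i) ∧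
      ∀ u < n, ∀ v < n, τ.arr aAdj (u * n + v) ≠ 0 ↔ ∃ i < m, tl i = u ∧ hd i = v := by
  have hn2 : 2 * n * n + 2 * n + 1 < 2 ^ w := by
    refine lt_of_lt_of_le ?_ hw
    nlinarith [sq_nonneg n, Nat.zero_le (n ^ 3), Nat.zero_le (n ^ 4)]
  refine WP.mono (WP.forTo (B := m) (K := 32) (I := fun k τ =>
    (∀ i < m + k, τ.arr aTail i = dblTail n m tl hd i) ∧
    (∀ i < m + k, τ.arr aTip i = dblTip n m tl hd i) ∧
    ∀ u < n, ∀ v < n, τ.arr aAdj (u * n + v) ≠ 0 ↔ ∃ i < k, tl i = u ∧ hd i = v)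
    (by omega) (by nlinarith) (by decide) rfl rfl hvm (fun _ _ _ h => h) ?_ ?_) ?_
  · refine ⟨fun i hi => ?_, fun i hi => ?_, fun u hu v hv => ?_⟩
    · rw [htl i hi, dblTail, if_pos (by simpa using hi)]
    · rw [hhd i hi, dblTip, if_pos (by simpa using hi)]
    · simp [hadj]
  · rintro k τ hk hF hvi ⟨h₁, h₂, h₃⟩
    have hvn' : τ.var vn = n := (hF.var vn rfl).trans hvn
    have hvm' : τ.var vm = m := (hF.var vm rfl).trans hvm
    have ht : τ.arr aTail k = tl k := by rw [h₁ k (by omega), dblTail, if_pos hk]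
    have hh : τ.arr aTip k = hd k := by rw [h₂ k (by omega), dblTip, if_pos hk]
    have htk := htn k hk
    have hhk := hhn k hk
    have hne : k ≠ m + k := by omega
    have hprod : tl k * n ≤ n * n := Nat.mul_le_mul_right _ htk.le
    -- the new arcs are appended beyond the cell that is read
    have hread : ((τ.setArr aTail (m + k) (n + hd k)).arr aTail) k = tl k := by
      simp [Function.update_of_ne hne, ht]
    have hread' : (((τ.setArr aTail (m + k) (n + hd k)).setArr aTip (m + k) (n + tl k)).arr
        aTip) k = hd k := by
      simp [Function.update_of_ne hne, hh]
    refine WP.seq (WP.store (j := m + k) (v := n + hd k)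
      (eval_add (eval_var hvm') (eval_var hvi) (by nlinarith))
      (eval_add (eval_var hvn') (eval_read hvi hh) (by nlinarith)) ?_)
    refine WP.seq (WP.store (j := m + k) (v := n + tl k)
      (eval_add (eval_var (by simpa using hvm')) (eval_var (by simpa using hvi)) (by nlinarith))
      (eval_add (eval_var (by simpa using hvn'))
        (eval_read (j := k) (eval_var (by simpa using hvi)) hread) (by nlinarith)) ?_)
    refine WP.store (j := tl k * n + hd k) (v := 1)
      (eval_add (eval_mul (eval_read (j := k) (eval_var (by simpa using hvi)) hread)
        (eval_var (by simpa using hvn')) (by nlinarith))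
        (eval_read (j := k) (eval_var (by simpa using hvi)) hread') (by nlinarith))
      (eval_const (by omega)) ?_
    refine ⟨by simp [Expr.cost], fun i hi => ?_, fun i hi => ?_, fun u hu v hv => ?_⟩
    · rcases (show i < m + k ∨ i = m + k by omega) with hi | rfl
      · have hne' : i ≠ m + k := by omega
        simpa [Function.update_of_ne hne'] using h₁ i hi
      · simp [dblTail]
    · rcases (show i < m + k ∨ i = m + k by omega) with hi | rfl
      · have hne' : i ≠ m + k := by omega
        simpa [Function.update_of_ne hne'] using h₂ i hi
      · simp [dblTip]
    · by_cases huv : tl k = u ∧ hd k = v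
      · obtain ⟨rfl, rfl⟩ := huv
        simp only [setArr_arr_self, Function.update_self]
        exact ⟨fun _ => ⟨k, by omega, rfl, rfl⟩, fun _ => one_ne_zero⟩
      · -- different pairs have different cells
        have : u * n + v ≠ tl k * n + hd k := by
          intro he
          have h' : u = tl k := by
            have := congrArg (· / n) he
            simpa [Nat.mul_comm _ n, Nat.mul_add_div (by omega : n > 0), Nat.div_eq_of_lt hv,
              Nat.div_eq_of_lt hhk] using this
          subst h'
          exact huv ⟨rfl, by omega⟩
        simp only [setArr_arr_self, Function.update_of_ne this]
        have hA : ∀ τ' : State, τ'.arr aAdj (u * n + v) = τ.arr aAdj (u * n + v) →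
            (τ'.arr aAdj (u * n + v) ≠ 0 ↔ ∃ i < k + 1, tl i = u ∧ hd i = v) := by
          intro τ' h
          rw [h, h₃ u hu v hv]
          constructor
          · rintro ⟨i, hi, h⟩
            exact ⟨i, by omega, h⟩
          · rintro ⟨i, hi, h⟩
            rcases Nat.lt_succ_iff_lt_or_eq.1 hi with hi | rfl
            · exact ⟨i, hi, h⟩
            · exact absurd h huv
        exact hA _ (by simp)
  · rintro t τ hF ⟨ht, h⟩
    exact ⟨by omega, h⟩

/-- The indices below `k` of the arcs that leave `x`, in decreasing order. -/
def arcsFrom (src : ℕ → ℕ) (k x : ℕ) : List ℕ := ((List.range k).filter (src · = x)).reverse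

theorem mem_arcsFrom {src : ℕ → ℕ} {k x i : ℕ} : i ∈ arcsFrom src k x ↔ i < k ∧ src i = x := by
  simp [arcsFrom]

theorem Links.congr {next next' : ℕ → ℕ} {p : ℕ} {l : List ℕ} (h : Links next p l)
    (hl : ∀ i ∈ l, next' i = next i) : Links next' p l := by
  induction h with
  | nil => exact .nil
  | @cons p l h ih =>
    refine .cons ?_
    rw [hl p (by simp)]
    exact ih fun i hi => hl i (by simp [hi])

theorem wp_link {src : ℕ → ℕ} {M : ℕ} (hw : M + 1 < 2 ^ w) (hvM : σ.var vM = M)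
    (hsrc : ∀ i < M, σ.arr aTail i = src i) (hfirst : σ.arr aFirst = fun _ => 0) :
    WP w link σ fun t τ => t ≤ M * 30 + 6 ∧
      ∀ x, Links (τ.arr aNext) (τ.arr aFirst x) (arcsFrom src M x) := by
  refine WP.mono (WP.forTo (B := M) (K := 20) (I := fun k τ =>
    ∀ x, Links (τ.arr aNext) (τ.arr aFirst x) (arcsFrom src k x))
    (by omega) (by omega) (by decide) rfl rfl hvM (fun _ _ _ h => h) ?_ ?_) ?_
  · intro x
    rw [hfirst]
    exact .nil
  · rintro k τ hk hF hvi h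
    have hs : τ.arr aTail k = src k := by rw [hF.arr aTail rfl, hsrc k hk]
    refine WP.seq (WP.store (j := k) (v := τ.arr aFirst (src k)) hvi
      (eval_read (eval_read (eval_var hvi) hs) rfl) ?_)
    refine WP.store (j := src k) (v := k + 1)
      (eval_read (j := k) (eval_var (by simpa using hvi)) (by simp [hs]))
      (eval_add (eval_var (by simpa using hvi)) (eval_const (by omega)) (by omega)) ?_
    refine ⟨by simp [Expr.cost], fun x => ?_⟩
    have hold : ∀ y, Links (Function.update (τ.arr aNext) k (τ.arr aFirst (src k)))
        (τ.arr aFirst y) (arcsFrom src k y) := fun y => (h y).congr fun i hi => by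
      rw [Function.update_of_ne (mem_arcsFrom.1 hi).1.ne]
    by_cases hx : src k = x
    · subst hx
      have : arcsFrom src (k + 1) (src k) = k :: arcsFrom src k (src k) := by
        simp [arcsFrom, List.range_succ]
      rw [this]
      simp only [setArr_arr_self, Function.update_self]
      refine .cons ?_
      simpa using hold (src k)
    · have : arcsFrom src (k + 1) x = arcsFrom src k x := by
        simp [arcsFrom, List.range_succ, hx]
      rw [this]
      simpa [Ne.symm hx] using hold x
  · rintro t τ hF ⟨ht, h⟩
    exact ⟨by omega, h⟩

end

/-! ### The doubled graph -/

/-- `d` is the distance function of a strongly connected graph on the vertices below `n` with the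
adjacency relation `A`. -/
structure GraphDist (n : ℕ) (A : ℕ → ℕ → Prop) (d : ℕ → ℕ → ℕ) : Prop where
  zero : ∀ {u v}, u < n → v < n → (d u v = 0 ↔ u = v)
  triangle : ∀ {u v x}, u < n → v < n → x < n → d u x ≤ d u v + d v x
  adj : ∀ {u v}, A u v → d u v ≤ 1
  pred : ∀ {u v k}, u < n → v < n → d u v = k + 1 → ∃ p < n, A p v ∧ d u p = k
  succ : ∀ {u v k}, u < n → v < n → d u v = k + 1 → ∃ p < n, A u p ∧ d p v = k

/-- The adjacency relation of the graph with the arcs from `tl i` to `hd i`, `i < m`. -/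
def ArcAdj (m : ℕ) (tl hd : ℕ → ℕ) (u v : ℕ) : Prop := ∃ i < m, tl i = u ∧ hd i = v

/-- The adjacency relation of the doubled graph: the graph on the vertices below `n`, and its
reversal on the vertices from `n` on. -/
def DblAdj (n m : ℕ) (tl hd : ℕ → ℕ) : ℕ → ℕ → Prop :=
  ArcAdj (m + m) (dblTail n m tl hd) (dblTip n m tl hd)

/-- The component of the vertex `a` in the doubled graph. -/
def comp (n a : ℕ) : Finset ℕ := if a < n then Finset.range n else Finset.Ico n (n + n)

/-- The distance from `a` within its component of the doubled graph. -/
def dblDist (n : ℕ) (d : ℕ → ℕ → ℕ) (a x : ℕ) : ℕ := if a < n then d a x else d (x - n) (a - n)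

/-- The out-degree in the doubled graph. -/
def dblDeg (n m : ℕ) (tl hd : ℕ → ℕ) (x : ℕ) : ℕ :=
  (arcsFrom (dblTail n m tl hd) (m + m) x).length

/-- The data of a run: word length, a strongly connected graph with `n` vertices, `m` arcs and
distances `d`, and the size `s` of the balls. -/
structure Setting (w n m s : ℕ) (tl hd : ℕ → ℕ) (d : ℕ → ℕ → ℕ) : Prop where
  pos : 0 < n
  word : (n + 2) ^ 4 ≤ 2 ^ w
  tl_lt : ∀ i < m, tl i < n
  hd_lt : ∀ i < m, hd i < n
  inj : ∀ i < m, ∀ j < m, tl i = tl j → hd i = hd j → i = j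
  arcs_le : m ≤ n * n
  dist : GraphDist n (ArcAdj m tl hd) d
  size_pos : 1 ≤ s
  size_le : s ≤ n

section

variable {w n m s : ℕ} {tl hd : ℕ → ℕ} {d : ℕ → ℕ → ℕ}

theorem mem_comp {a x : ℕ} :
    x ∈ comp n a ↔ (a < n ∧ x < n) ∨ (n ≤ a ∧ n ≤ x ∧ x < n + n) := by
  unfold comp
  split_ifs with h
  · simp [h]
  · simp only [Finset.mem_Ico]
    omega

theorem comp_lt {a x : ℕ} (hx : x ∈ comp n a) : x < n + n := by
  unfold comp at hx
  split_ifs at hx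
  · simp at hx
    omega
  · simp at hx
    omega

theorem card_comp (a : ℕ) : (comp n a).card = n := by
  unfold comp
  split_ifs <;> simp

theorem Setting.word_bound (h : Setting w n m s tl hd d) : 8 * (n * n) + 8 * n + 8 < 2 ^ w := by
  have := h.pos
  refine lt_of_lt_of_le ?_ h.word
  nlinarith [sq_nonneg n, Nat.zero_le (n ^ 3), Nat.zero_le (n ^ 4)]

theorem Setting.dblAdj (h : Setting w n m s tl hd d) {x y : ℕ} (hxy : DblAdj n m tl hd x y) :
    (x < n ∧ y < n ∧ ArcAdj m tl hd x y) ∨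
      (n ≤ x ∧ x < n + n ∧ n ≤ y ∧ y < n + n ∧ ArcAdj m tl hd (y - n) (x - n)) := by
  obtain ⟨i, hi, rfl, rfl⟩ := hxy
  unfold dblTail dblTip
  split_ifs with him
  · exact .inl ⟨h.tl_lt i him, h.hd_lt i him, i, him, rfl, rfl⟩
  · have h₁ := h.tl_lt (i - m) (by omega)
    have h₂ := h.hd_lt (i - m) (by omega)
    exact .inr ⟨by omega, by omega, by omega, by omega, i - m, by omega, by omega, by omega⟩

theorem dblAdj_of_adj {u v : ℕ} (h : ArcAdj m tl hd u v) : DblAdj n m tl hd u v := by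
  obtain ⟨i, hi, rfl, rfl⟩ := h
  exact ⟨i, by omega, by simp [dblTail, hi], by simp [dblTip, hi]⟩

theorem dblAdj_rev {u v : ℕ} (h : ArcAdj m tl hd u v) :
    DblAdj n m tl hd (n + v) (n + u) := by
  obtain ⟨i, hi, rfl, rfl⟩ := h
  exact ⟨m + i, by omega, by simp [dblTail], by simp [dblTip]⟩

theorem Setting.distFrom (h : Setting w n m s tl hd d) {a : ℕ} (ha : a < n + n) :
    DistFrom (DblAdj n m tl hd) (comp n a) a (dblDist n d a) := by
  have hc : ∀ {x}, x ∈ comp n a ↔ (a < n ∧ x < n) ∨ (n ≤ a ∧ n ≤ x ∧ x < n + n) := mem_comp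
  refine { root := by rw [hc]; omega, closed := ?_, zero := ?_, adj := ?_, pred := ?_ }
  · intro x y hx hxy
    rw [hc] at hx ⊢
    rcases h.dblAdj hxy with ⟨h₁, h₂, -⟩ | ⟨h₁, h₂, h₃, h₄, -⟩ <;> omega
  · intro x hx
    unfold dblDist
    rcases hc.1 hx with ⟨ha', hx'⟩ | ⟨ha', hx', hx''⟩
    · rw [if_pos ha', h.dist.zero ha' hx', eq_comm]
    · rw [if_neg (by omega), h.dist.zero (by omega) (by omega)]
      omega
  · intro x y hx hxy
    unfold dblDist
    rcases hc.1 hx with ⟨ha', hx'⟩ | ⟨ha', hx', hx''⟩ <;>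
      rcases h.dblAdj hxy with ⟨h₁, h₂, hA⟩ | ⟨h₁, h₂, h₃, h₄, hA⟩ <;> try omega
    · rw [if_pos ha', if_pos ha']
      exact (h.dist.triangle ha' h₁ h₂).trans (Nat.add_le_add_left (h.dist.adj hA) _)
    · rw [if_neg (by omega), if_neg (by omega), add_comm]
      exact (h.dist.triangle (v := x - n) (by omega) (by omega) (by omega)).trans
        (Nat.add_le_add_right (h.dist.adj hA) _)
  · intro y k hy hk
    unfold dblDist at hk ⊢
    rcases hc.1 hy with ⟨ha', hy'⟩ | ⟨ha', hy', hy''⟩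
    · rw [if_pos ha'] at hk
      obtain ⟨p, hp, hA, hpk⟩ := h.dist.pred ha' hy' hk
      exact ⟨p, hc.2 (.inl ⟨ha', hp⟩), dblAdj_of_adj hA, by rwa [if_pos ha']⟩
    · rw [if_neg (by omega)] at hk
      obtain ⟨p, hp, hA, hpk⟩ := h.dist.succ (by omega) (by omega) hk
      refine ⟨n + p, hc.2 (.inr ⟨ha', by omega, by omega⟩), ?_, ?_⟩
      · simpa [Nat.add_sub_cancel' hy'] using dblAdj_rev (n := n) hA
      · rw [if_neg (by omega)]
        simpa using hpk

theorem dblDeg_eq_card (x : ℕ) : dblDeg n m tl hd x =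
    ((Finset.range (m + m)).filter (dblTail n m tl hd · = x)).card := by
  rw [dblDeg, arcsFrom, List.length_reverse, ← Multiset.coe_card, ← Multiset.filter_coe]
  rfl

theorem sum_dblDeg_le (S : Finset ℕ) : ∑ x ∈ S, dblDeg n m tl hd x ≤ m + m := by
  simp only [dblDeg_eq_card]
  rw [Finset.sum_card_fiberwise_eq_card_filter]
  exact (Finset.card_filter_le _ _).trans (by simp)

theorem Setting.dblDeg_le (h : Setting w n m s tl hd d) (x : ℕ) :
    dblDeg n m tl hd x ≤ n + n := by
  rw [dblDeg_eq_card]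
  refine (Finset.card_le_card_of_injOn (t := Finset.range (n + n)) (dblTip n m tl hd) ?_ ?_).trans
    (by simp)
  · intro i hi
    simp only [Finset.coe_filter, Finset.mem_range, Set.mem_ofPred_eq] at hi
    rcases h.dblAdj ⟨i, hi.1, rfl, rfl⟩ with ⟨-, h₂, -⟩ | ⟨-, -, -, h₂, -⟩ <;>
      simp only [Finset.coe_range, Set.mem_Iio] <;> omega
  · intro i hi j hj hij
    simp only [Finset.coe_filter, Finset.mem_range, Set.mem_ofPred_eq] at hi hj
    obtain ⟨hi, rfl⟩ := hi
    obtain ⟨hj, hji⟩ := hj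
    unfold dblTail at hji
    unfold dblTip at hij
    split_ifs at hji hij with h₁ h₂ h₂
    · exact h.inj i h₂ j h₁ hji.symm hij
    · have := h.tl_lt j h₁
      omega
    · have := h.tl_lt i h₂
      omega
    · have := h.inj (i - m) (by omega) (j - m) (by omega) (by omega) (by omega)
      omega

end

/-- The state after the preparation of the input, as far as it does not change any more. -/
structure Ready (w n m s : ℕ) (tl hd : ℕ → ℕ) (σ : State) : Prop where
  var_n : σ.var vn = n
  var_N : σ.var vN = n + n
  var_s : σ.var vs = s
  rep : ∀ a, Represents w σ (DblAdj n m tl hd) (comp n a) (dblDeg n m tl hd)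
  matrix : ∀ u < n, ∀ v < n, σ.arr aAdj (u * n + v) ≠ 0 ↔ ArcAdj m tl hd u v

theorem Ready.congr {w n m s : ℕ} {tl hd : ℕ → ℕ} {σ τ : State} (h : Ready w n m s tl hd σ)
    (h₀ : τ.var vn = σ.var vn) (h₁ : τ.var vN = σ.var vN) (h₂ : τ.var vs = σ.var vs)
    (h₃ : τ.arr aTip = σ.arr aTip) (h₄ : τ.arr aFirst = σ.arr aFirst)
    (h₅ : τ.arr aNext = σ.arr aNext) (h₆ : τ.arr aAdj = σ.arr aAdj) :
    Ready w n m s tl hd τ where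
  var_n := h₀.trans h.var_n
  var_N := h₁.trans h.var_N
  var_s := h₂.trans h.var_s
  rep a x hx := by simpa only [h₃, h₄, h₅] using h.rep a x hx
  matrix := by simpa only [h₆] using h.matrix

/-- A program that does not write to the prepared data leaves it intact. -/
theorem Ready.frame {w n m s : ℕ} {tl hd : ℕ → ℕ} {σ τ : State} {p : Program}
    (h : Ready w n m s tl hd σ) (hF : p.Frame σ τ) (hv : (p.modVar vn || p.modVar vN ||
      p.modVar vs || p.modArr aTip || p.modArr aFirst || p.modArr aNext || p.modArr aAdj) = false) :
    Ready w n m s tl hd τ := by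
  simp only [Bool.or_eq_false_iff] at hv
  obtain ⟨⟨⟨⟨⟨⟨h₀, h₁⟩, h₂⟩, h₃⟩, h₄⟩, h₅⟩, h₆⟩ := hv
  exact h.congr (hF.var _ h₀) (hF.var _ h₁) (hF.var _ h₂) (hF.arr _ h₃) (hF.arr _ h₄) (hF.arr _ h₅)
    (hF.arr _ h₆)

/-- Everything up to the linked lists and the adjacency matrix. -/
def prepare : Program :=
  vN ::= .var vn ⊞ .var vn ;; vM ::= .var vm ⊞ .var vm ;; findSize ;; double ;; link

theorem wp_prepare {w n m : ℕ} {tl hd : ℕ → ℕ} {d : ℕ → ℕ → ℕ} {σ : State}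
    (h : Setting w n m 1 tl hd d) (hvn : σ.var vn = n) (hvm : σ.var vm = m)
    (htl : ∀ i < m, σ.arr aTail i = tl i) (hhd : ∀ i < m, σ.arr aTip i = hd i)
    (hadj : σ.arr aAdj = fun _ => 0) (hfirst : σ.arr aFirst = fun _ => 0) :
    WP w prepare σ fun t τ => t ≤ n * 30 + m * 100 + 60 ∧ ∃ s, Setting w n m s tl hd d ∧
      (s = 1 ∨ s ^ 3 * n ≤ m) ∧ m < (s + 1) ^ 3 * n ∧ Ready w n m s tl hd τ := by
  have hb := h.word_bound
  have hm := h.arcs_le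
  refine WP.seq (WP.assign (v := n + n) (eval_add (eval_var hvn) (eval_var hvn) (by omega)) ?_)
  refine WP.seq (WP.assign (v := m + m)
    (eval_add (eval_var (by simpa using hvm)) (eval_var (by simpa using hvm)) (by omega)) ?_)
  refine WP.seq (WP.mono (wp_findSize h.pos hm h.word (by simpa using hvn) (by simpa using hvm)) ?_)
  rintro t τ hF ⟨ht, hs₁, hs₂, hs₃, hs₄⟩
  have hvn' : τ.var vn = n := (hF.var vn rfl).trans (by simpa using hvn)
  refine WP.seq (WP.mono (wp_double (n := n) (m := m) (tl := tl) (hd := hd) h.word hm hvn'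
    ((hF.var vm rfl).trans (by simpa using hvm)) ?_ ?_ h.tl_lt h.hd_lt ?_) ?_)
  · simpa [hF.arr aTail rfl] using htl
  · simpa [hF.arr aTip rfl] using hhd
  · simpa [hF.arr aAdj rfl] using hadj
  rintro t' υ hG ⟨ht', hυ₁, hυ₂, hυ₃⟩
  refine WP.mono (wp_link (M := m + m) (by omega) ?_ hυ₁ ?_) ?_
  · rw [hG.var vM rfl, hF.var vM rfl]
    simp
  · rw [hG.arr aFirst rfl, hF.arr aFirst rfl]
    simpa using hfirst
  rintro t'' φ hH ⟨ht'', hφ⟩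
  refine ⟨by simp only [Expr.cost]; omega, τ.var vs, ⟨h.pos, h.word, h.tl_lt, h.hd_lt, h.inj,
    h.arcs_le, h.dist, hs₁, hs₂⟩, hs₃, hs₄, ?_⟩
  refine ⟨?_, ?_, ?_, ?_, ?_⟩
  · rw [hH.var vn rfl, hG.var vn rfl, hvn']
  · rw [hH.var vN rfl, hG.var vN rfl, hF.var vN rfl]
    simp
  · rw [hH.var vs rfl, hG.var vs rfl]
  · intro a x hx
    refine ⟨_, hφ x, rfl, fun p hp => ?_, fun y => ?_⟩
    · have := (mem_arcsFrom.1 hp).1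
      omega
    · rw [hH.arr aTip rfl]
      constructor
      · rintro ⟨i, hi, h₁, h₂⟩
        exact ⟨i, mem_arcsFrom.2 ⟨hi, h₁⟩, (hυ₂ i hi).trans h₂⟩
      · rintro ⟨i, hi, h₂⟩
        obtain ⟨hi, h₁⟩ := mem_arcsFrom.1 hi
        exact ⟨i, hi, h₁, (hυ₂ i hi).symm.trans h₂⟩
  · rw [hH.arr aAdj rfl]
    exact hυ₃

/-! ### The closest vertices of every vertex -/

/-- The index of entry `j` of the ball around the vertex `a`. -/
local notation "cell(" a "," j ")" => Expr.var a ⊠ Expr.var vs ⊞ Expr.var j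

/-- Store, for all vertices of the doubled graph, the closest vertices and their distances. -/
def balls : Program :=
  vCap ::= .var vs ;;
  forTo va vN
    (vRoot ::= .var va ;; bfs ;;
     forTo vj vs
      (.store aBall cell(va, vj) (.read aQueue (.var vj)) ;;
       .store aRad cell(va, vj) (.read aDist (.read aQueue (.var vj)) ⊟ .const 1)))

/-- The arrays `ball` and `rad` hold, for the vertices `a < k`, the `s` closest vertices and their
distances. -/
def BallsUpTo (n s : ℕ) (d : ℕ → ℕ → ℕ) (k : ℕ) (ball rad : ℕ → ℕ) : Prop :=
  ∀ a < k, Closest (comp n a) (dblDist n d a) s (fun i => ball (a * s + i)) ∧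
    ∀ i < s, rad (a * s + i) = dblDist n d a (ball (a * s + i))

section

variable {w n m s : ℕ} {tl hd : ℕ → ℕ} {d : ℕ → ℕ → ℕ} {σ : State}

theorem Setting.cell_lt (h : Setting w n m s tl hd d) {a i : ℕ} (ha : a < n + n) (hi : i < s) :
    a * s + i + 1 < 2 ^ w := by
  have h₁ := h.word_bound
  have h₂ : a * s ≤ (n + n) * n := Nat.mul_le_mul ha.le h.size_le
  have h₃ := h.size_le
  nlinarith

theorem Setting.eval_cell (h : Setting w n m s tl hd d) {x y a i : ℕ} (ha : a < n + n) (hi : i < s)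
    (hx : σ.var x = a) (hs : σ.var vs = s) (hy : σ.var y = i) :
    Expr.eval w σ cell(x, y) = a * s + i :=
  have hc := h.cell_lt ha hi
  eval_add (eval_mul (eval_var hx) (eval_var hs) (by omega)) (eval_var hy) (by omega)

theorem Setting.one_lt (h : Setting w n m s tl hd d) : 1 < 2 ^ w := by
  have := h.word_bound
  omega

theorem cell_lt_mul {a k s i : ℕ} (ha : a < k) (hi : i < s) : a * s + i < k * s :=
  calc a * s + i < (a + 1) * s := by rw [Nat.succ_mul]; omega
    _ ≤ k * s := Nat.mul_le_mul_right _ ha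

theorem wp_copyBall (h : Setting w n m s tl hd d) {k : ℕ} (hk : k < n + n) (hvs : σ.var vs = s)
    (hva : σ.var va = k) (hQ : Closest (comp n k) (dblDist n d k) s (σ.arr aQueue))
    (hdist : ∀ i < s, σ.arr aDist (σ.arr aQueue i) = dblDist n d k (σ.arr aQueue i) + 1)
    (hB : BallsUpTo n s d k (σ.arr aBall) (σ.arr aRad)) :
    WP w (forTo vj vs
      (.store aBall cell(va, vj) (.read aQueue (.var vj)) ;;
       .store aRad cell(va, vj) (.read aDist (.read aQueue (.var vj)) ⊟ .const 1))) σ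
      fun t τ => t ≤ s * 30 + 6 ∧ BallsUpTo n s d (k + 1) (τ.arr aBall) (τ.arr aRad) := by
  have hb := h.word_bound
  have hsn := h.size_le
  refine WP.mono (WP.forTo (B := s) (K := 22) (I := fun j τ =>
    BallsUpTo n s d k (τ.arr aBall) (τ.arr aRad) ∧
    ∀ i < j, τ.arr aBall (k * s + i) = σ.arr aQueue i ∧
      τ.arr aRad (k * s + i) = dblDist n d k (σ.arr aQueue i))
    h.one_lt (by nlinarith) (by decide) rfl rfl hvs (fun _ _ _ h => h) ⟨hB, by simp⟩ ?_) ?_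
  · rintro j τ hj hF hvj ⟨hB, hI⟩
    have hvs' : τ.var vs = s := (hF.var vs rfl).trans hvs
    have hva' : τ.var va = k := (hF.var va rfl).trans hva
    have hq : τ.arr aQueue = σ.arr aQueue := hF.arr aQueue rfl
    have hd : τ.arr aDist = σ.arr aDist := hF.arr aDist rfl
    have hlt : dblDist n d k (σ.arr aQueue j) < n := by
      simpa [card_comp] using (h.distFrom hk).lt_card (hQ.mem hj)
    refine WP.seq (WP.store (j := k * s + j) (v := σ.arr aQueue j) (h.eval_cell hk hj hva' hvs' hvj)
      (eval_read (eval_var hvj) (by rw [hq])) ?_)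
    refine WP.store (j := k * s + j) (v := dblDist n d k (σ.arr aQueue j))
      (h.eval_cell hk hj (by simpa using hva') (by simpa using hvs') (by simpa using hvj))
      (eval_sub (x := dblDist n d k (σ.arr aQueue j) + 1) (y := 1)
        (eval_read (j := σ.arr aQueue j) (eval_read (eval_var (by simpa using hvj)) (by simp [hq]))
        (by simp [hd, hdist j hj])) (eval_const h.one_lt) (by nlinarith)) ?_
    refine ⟨by simp [Expr.cost], fun a ha => ?_, fun i hi => ?_⟩
    · have hne : ∀ i < s, a * s + i ≠ k * s + j := fun i hi => by
        have := cell_lt_mul ha hi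
        omega
      obtain ⟨hC, hR⟩ := hB a ha
      refine ⟨hC.congr fun i hi => ?_, fun i hi => ?_⟩
      · simp [Function.update_of_ne (hne i hi)]
      · simpa [Function.update_of_ne (hne i hi)] using hR i hi
    · by_cases hij : i = j
      · subst hij
        simp
      · have hne : k * s + i ≠ k * s + j := by omega
        simpa [Function.update_of_ne hne] using hI i (by omega)
  · rintro t τ hF ⟨ht, hB, hI⟩
    refine ⟨by omega, fun a ha => ?_⟩
    rcases Nat.lt_succ_iff_lt_or_eq.1 ha with ha | rfl
    · exact hB a ha
    · refine ⟨hQ.congr fun i hi => (hI i hi).1, fun i hi => ?_⟩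
      rw [(hI i hi).2, (hI i hi).1]

theorem wp_balls (h : Setting w n m s tl hd d) (hσ : Ready w n m s tl hd σ) :
    WP w balls σ fun t τ => t ≤ n * n * s * 600 + 20 ∧
      BallsUpTo n s d (n + n) (τ.arr aBall) (τ.arr aRad) := by
  have hb := h.word_bound
  have hsn := h.size_le
  refine WP.seq (WP.assign (v := s) (eval_var hσ.var_s) ?_)
  refine WP.mono (WP.forTo (B := n + n) (K := n * 80 + (s * (n + n)) * 40 + s * 30 + 60)
    (I := fun k τ => BallsUpTo n s d k (τ.arr aBall) (τ.arr aRad))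
    h.one_lt (by omega) (by decide) rfl rfl (by simpa using hσ.var_N) (fun _ _ _ h => h)
    (fun a ha => absurd ha (by omega)) ?_) ?_
  · rintro k τ hk hF hva hI
    have hτ : Ready w n m s tl hd τ :=
      (hσ.congr (τ := σ.setVar vCap s) rfl rfl rfl rfl rfl rfl rfl).frame hF rfl
    refine WP.seq (WP.assign (v := k) hva ?_)
    refine WP.seq (WP.mono (wp_bfs (cap := s) (W := s * (n + n)) (N := n + n) h.one_lt (by omega)
      (fun x hx => comp_lt hx) (h.distFrom hk) (hτ.rep k) (by simpa using hτ.var_N) (by simp) ?_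
      (by rwa [card_comp]) ?_) ?_)
    · simpa using hF.var vCap rfl
    · intro S _ hS
      exact (Finset.sum_le_card_nsmul _ _ _ fun x _ => h.dblDeg_le x).trans
        (Nat.mul_le_mul_right _ hS)
    · rintro t υ hG ⟨ht, hQ, hdist⟩
      refine WP.mono (wp_copyBall h hk ?_ ?_ hQ hdist ?_) ?_
      · rw [hG.var vs rfl]
        simpa using hτ.var_s
      · rw [hG.var va rfl]
        simpa using hva
      · rw [hG.arr aBall rfl, hG.arr aRad rfl]
        exact hI
      · rintro t' φ hH ⟨ht', hφ⟩
        refine ⟨?_, hφ⟩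
        simp only [Expr.cost]
        omega
  · rintro t τ hF ⟨ht, hI⟩
    refine ⟨?_, hI⟩
    have h₁ : n * n ≤ n * n * s := Nat.le_mul_of_pos_right _ h.size_pos
    have h₂ : n * s ≤ n * n * s := Nat.mul_le_mul_right _ (Nat.le_mul_of_pos_left _ h.pos)
    have h₃ : n ≤ n * n := Nat.le_mul_of_pos_left _ h.pos
    simp only [Expr.cost]
    nlinarith

end

/-! ### A hitting set, chosen greedily -/

/-- Count, for every vertex, the balls that contain it and have not been hit. -/
def countBalls : Program :=
  forTo vi vN (.store aCount (.var vi) (.const 0)) ;;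
  forTo va vN
    (.ite (.read aHit (.var va) ≐ .const 0)
      (forTo vj vs
        (.store aCount (.read aBall cell(va, vj))
          (.read aCount (.read aBall cell(va, vj)) ⊞ .const 1)))
      .skip)

/-- Find a vertex with the largest count. -/
def findMax : Program :=
  vMax ::= .const 0 ;;
  forTo vi vN (.ite (.read aCount (.var vMax) ≺ .read aCount (.var vi)) (vMax ::= .var vi) .skip)

/-- Mark the balls that contain the chosen vertex as hit. -/
def markBalls : Program :=
  forTo va vN
    (forTo vj vs
      (.ite (.read aBall cell(va, vj) ≐ .var vMax) (.store aHit (.var va) (.const 1)) .skip))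

/-- Raise the estimate to the eccentricity of the chosen vertex. -/
def measure : Program :=
  vRoot ::= .var vMax ;; bfs ;;
  vz ::= .read aDist (.read aQueue (.var vn ⊟ .const 1)) ⊟ .const 1 ;;
  .ite (.var vBest ≺ .var vz) (vBest ::= .var vz) .skip

/-- One round of the greedy choice. -/
def greedyRound : Program :=
  countBalls ;; findMax ;; markBalls ;; measure ;; vGo ::= .read aCount (.var vMax)

/-- Choose vertices greedily until they hit all balls. -/
def greedy : Program :=
  vCap ::= .var vn ;; vGo ::= .const 1 ;; .loop (.var vGo) greedyRound

/-- The number of indices `i < j` at which the ball of `a` has the entry `x`. -/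
def occ (s : ℕ) (ball : ℕ → ℕ) (a j x : ℕ) : ℕ :=
  ((Finset.range j).filter fun i => ball (a * s + i) = x).card

/-- The number of vertices `a < k` that have not been hit and whose ball contains `x`, counted with
multiplicity. -/
def count (s : ℕ) (hit ball : ℕ → ℕ) (k x : ℕ) : ℕ :=
  ∑ a ∈ Finset.range k, if hit a = 0 then occ s ball a s x else 0

/-- The number of balls that have not been hit. -/
def unhit (n : ℕ) (hit : ℕ → ℕ) : ℕ := ((Finset.range (n + n)).filter fun a => hit a = 0).card

/-- The ball of `a` contains a vertex whose eccentricity does not exceed `best`. -/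
def Covered (n s : ℕ) (d : ℕ → ℕ → ℕ) (ball : ℕ → ℕ) (best a : ℕ) : Prop :=
  ∃ i < s, ∀ y ∈ comp n a, dblDist n d (ball (a * s + i)) y ≤ best

section

variable {w n m s : ℕ} {tl hd : ℕ → ℕ} {d : ℕ → ℕ → ℕ} {σ : State}

theorem occ_succ (s : ℕ) (ball : ℕ → ℕ) (a j x : ℕ) :
    occ s ball a (j + 1) x = occ s ball a j x + if ball (a * s + j) = x then 1 else 0 := by
  unfold occ
  rw [Finset.range_add_one, Finset.filter_insert]
  split_ifs
  · rw [Finset.card_insert_of_notMem (by simp)]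
  · rfl

theorem occ_le (s : ℕ) (ball : ℕ → ℕ) (a j x : ℕ) : occ s ball a j x ≤ j :=
  (Finset.card_filter_le _ _).trans (by simp)

theorem count_le (s : ℕ) (hit ball : ℕ → ℕ) (k x : ℕ) : count s hit ball k x ≤ k * s := by
  refine (Finset.sum_le_card_nsmul _ _ s fun a _ => ?_).trans (by simp)
  split_ifs
  · exact occ_le _ _ _ _ _
  · exact Nat.zero_le _

theorem sum_count {hit ball : ℕ → ℕ} (hB : ∀ a < n + n, ∀ i < s, ball (a * s + i) < n + n) :
    ∑ x ∈ Finset.range (n + n), count s hit ball (n + n) x = s * unhit n hit := by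
  unfold count unhit
  rw [Finset.sum_comm, Finset.card_filter, Finset.mul_sum]
  refine Finset.sum_congr rfl fun a ha => ?_
  split_ifs
  · unfold occ
    rw [← Finset.card_eq_sum_card_fiberwise (f := fun i => ball (a * s + i)), Finset.card_range,
      mul_one]
    intro i hi
    simpa using hB a (by simpa using ha) i (by simpa using hi)
  · simp

/-- A vertex with the largest count hits at least the average number of balls. -/
theorem greedy_progress {hit hit' ball rad : ℕ → ℕ} {x : ℕ}
    (hB : BallsUpTo n s d (n + n) ball rad)
    (hmax : ∀ y < n + n, count s hit ball (n + n) y ≤ count s hit ball (n + n) x)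
    (hhit : ∀ a < n + n, hit' a = 0 ↔ hit a = 0 ∧ ¬∃ i < s, ball (a * s + i) = x) :
    s * unhit n hit ≤ (n + n) * count s hit ball (n + n) x ∧
      count s hit ball (n + n) x + unhit n hit' ≤ unhit n hit := by
  constructor
  · rw [← sum_count (ball := ball) fun a ha i hi => comp_lt ((hB a ha).1.mem hi)]
    refine (Finset.sum_le_card_nsmul _ _ _ fun y hy => hmax y (by simpa using hy)).trans (by simp)
  · simp only [count, unhit, Finset.card_filter]
    rw [← Finset.sum_add_distrib]
    refine Finset.sum_le_sum fun a ha => ?_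
    have ha : a < n + n := by simpa using ha
    have hocc : occ s ball a s x ≤ 1 := by
      refine Finset.card_le_one.2 fun i hi j hj => ?_
      simp only [Finset.mem_filter, Finset.mem_range] at hi hj
      exact (hB a ha).1.inj hi.1 hj.1 (hi.2.trans hj.2.symm)
    have hocc' : (¬∃ i < s, ball (a * s + i) = x) ∨ ∃ i < s, ball (a * s + i) = x := by tauto
    rcases hocc' with he | he
    · have : occ s ball a s x = 0 := by
        refine Finset.card_eq_zero.2 (Finset.filter_eq_empty_iff.2 fun i hi hx => ?_)
        exact he ⟨i, by simpa using hi, hx⟩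
      simp [hhit a ha, this, he]
    · simp only [hhit a ha, he, not_true_eq_false, and_false, if_false, add_zero]
      split_ifs
      · exact hocc
      · exact le_rfl

/-- A complete list of closest vertices ends with a vertex at the largest distance. -/
theorem Closest.le_last {V : Finset ℕ} {δ Q : ℕ → ℕ} {k : ℕ} (h : Closest V δ k Q)
    (hk : V.card = k) {y : ℕ} (hy : y ∈ V) : δ y ≤ δ (Q (k - 1)) := by
  have hsub : (Finset.range k).image Q = V := by
    refine Finset.eq_of_subset_of_card_le (fun x hx => ?_) ?_
    · obtain ⟨i, hi, rfl⟩ := Finset.mem_image.1 hx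
      exact h.mem (by simpa using hi)
    · rw [Finset.card_image_of_injOn, Finset.card_range, hk]
      exact fun i hi j hj => h.inj (by simpa using hi) (by simpa using hj)
  rw [← hsub] at hy
  obtain ⟨i, hi, rfl⟩ := Finset.mem_image.1 hy
  rw [Finset.mem_range] at hi
  exact h.mono (by omega) (by omega)

theorem wp_countBalls (h : Setting w n m s tl hd d) (hσ : Ready w n m s tl hd σ)
    (hB : BallsUpTo n s d (n + n) (σ.arr aBall) (σ.arr aRad)) :
    WP w countBalls σ fun t τ => t ≤ n * s * 200 + 12 ∧
      ∀ x < n + n, τ.arr aCount x = count s (σ.arr aHit) (σ.arr aBall) (n + n) x := by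
  have hw := h.one_lt
  have hb := h.word_bound
  have hsn := h.size_le
  refine WP.seq (WP.mono (WP.forTo (B := n + n) (K := 5)
    (I := fun k τ => ∀ x < k, τ.arr aCount x = 0) hw (by omega) (by decide) rfl rfl hσ.var_N
    (fun _ _ _ h => h) (by simp) ?_) ?_)
  · intro k τ hk hF hvi hI
    refine WP.store (j := k) (v := 0) hvi (eval_const (by omega)) ⟨by simp [Expr.cost], ?_⟩
    intro x hx
    by_cases hxk : x = k
    · simp [hxk]
    · simpa [hxk] using hI x (by omega)
  rintro t τ hF ⟨ht, hI⟩
  have hhit : τ.arr aHit = σ.arr aHit := hF.arr aHit rfl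
  have hball : τ.arr aBall = σ.arr aBall := hF.arr aBall rfl
  have hτ : Ready w n m s tl hd τ := hσ.frame hF rfl
  refine WP.mono (WP.forTo (B := n + n) (K := s * 28 + 12) (I := fun k τ =>
    ∀ x < n + n, τ.arr aCount x = count s (σ.arr aHit) (σ.arr aBall) k x) hw (by omega)
    (by decide) rfl rfl hτ.var_N (fun _ _ _ h => h) (fun x hx => by simp [hI x hx, count]) ?_) ?_
  · intro k υ hk hG hva hI
    have hυ : Ready w n m s tl hd υ := hτ.frame hG rfl
    have hhit' : υ.arr aHit = σ.arr aHit := (hG.arr aHit rfl).trans hhit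
    have hball' : υ.arr aBall = σ.arr aBall := (hG.arr aBall rfl).trans hball
    refine WP.ite (fun he => ?_) (fun he => ?_)
    · rw [eval_eq_ne_zero hw, eval_const (by omega), eval_read (eval_var hva) rfl, hhit'] at he
      refine WP.mono (WP.forTo (B := s) (K := 20) (I := fun j φ => ∀ x < n + n,
        φ.arr aCount x = υ.arr aCount x + occ s (σ.arr aBall) k j x) hw (by omega) (by decide)
        rfl rfl hυ.var_s (fun _ _ _ h => h) (fun x hx => by simp [occ]) ?_) ?_
      · intro j φ hj hH hvj hJ
        have hva' : φ.var va = k := (hH.var va rfl).trans hva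
        have hvs' : φ.var vs = s := (hH.var vs rfl).trans hυ.var_s
        have hball'' : φ.arr aBall = σ.arr aBall := (hH.arr aBall rfl).trans hball'
        set x := σ.arr aBall (k * s + j) with hx
        have hxN : x < n + n := comp_lt ((hB k hk).1.mem hj)
        have hread : (Expr.read aBall cell(va, vj)).eval w φ = x :=
          eval_read (h.eval_cell hk hj hva' hvs' hvj) (by rw [hball''])
        have hc := h.cell_lt hk hj
        have h₁ := count_le s (σ.arr aHit) (σ.arr aBall) k x
        have h₂ := occ_le s (σ.arr aBall) k j x
        have h₃ := hJ x hxN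
        rw [hI x hxN] at h₃
        refine WP.store (j := x) (v := φ.arr aCount x + 1) hread
          (eval_add (eval_read hread rfl) (eval_const hw) (by omega)) ⟨by simp [Expr.cost], ?_⟩
        intro y hy
        rw [occ_succ, ← hx]
        by_cases hyx : y = x
        · rw [hyx]
          simp [hJ x hxN, add_assoc]
        · simp [hyx, Ne.symm hyx, hJ y hy]
      · rintro t φ hH ⟨ht, hJ⟩
        refine ⟨by simp only [Expr.cost]; omega, fun x hx => ?_⟩
        rw [hJ x hx, hI x hx, count, count, Finset.sum_range_succ, if_pos he]
    · rw [eval_eq_eq_zero hw, eval_const (by omega), eval_read (eval_var hva) rfl, hhit'] at he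
      refine WP.skip ⟨by simp only [Expr.cost]; omega, fun x hx => ?_⟩
      rw [hI x hx, count, count, Finset.sum_range_succ, if_neg he, add_zero]
  · rintro t' υ hG ⟨ht', hI⟩
    refine ⟨?_, hI⟩
    have : n ≤ n * s := Nat.le_mul_of_pos_right _ h.size_pos
    have : (n + n) * (s * 28 + 12 + 8) = n * s * 56 + n * 40 := by ring
    omega

theorem wp_findMax (h : Setting w n m s tl hd d) (hσ : Ready w n m s tl hd σ) :
    WP w findMax σ fun t τ => t ≤ n * 50 + 8 ∧ τ.var vMax < n + n ∧
      ∀ x < n + n, σ.arr aCount x ≤ σ.arr aCount (τ.var vMax) := by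
  have hw := h.one_lt
  have hb := h.word_bound
  have hn := h.pos
  refine WP.seq (WP.assign (v := 0) (eval_const (by omega)) ?_)
  refine WP.mono (WP.forTo (B := n + n) (K := 10) (I := fun k τ => τ.var vMax < n + n ∧
    ∀ x < k, σ.arr aCount x ≤ σ.arr aCount (τ.var vMax)) hw (by omega) (by decide) rfl rfl
    (by simpa using hσ.var_N) (fun _ _ _ h => h) ⟨by simp; omega, by simp⟩ ?_) ?_
  · rintro k τ hk hF hvi ⟨hI₁, hI₂⟩
    have hc : τ.arr aCount = σ.arr aCount := hF.arr aCount rfl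
    refine WP.ite (fun he => ?_) (fun he => ?_)
    · rw [eval_lt_ne_zero hw, eval_read (eval_var rfl) rfl, eval_read (eval_var hvi) rfl, hc] at he
      refine WP.assign (v := k) hvi ⟨by simp [Expr.cost], by simpa using hk, fun x hx => ?_⟩
      rw [setVar_var_self]
      rcases Nat.lt_succ_iff_lt_or_eq.1 hx with hx | rfl
      · exact (hI₂ x hx).trans he.le
      · exact le_rfl
    · rw [eval_lt_eq_zero hw, eval_read (eval_var hvi) rfl, eval_read (eval_var rfl) rfl, hc] at he
      refine WP.skip ⟨by simp [Expr.cost], hI₁, fun x hx => ?_⟩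
      rcases Nat.lt_succ_iff_lt_or_eq.1 hx with hx | rfl
      · exact hI₂ x hx
      · exact he
  · rintro t τ hF ⟨ht, hI⟩
    exact ⟨by simp only [Expr.cost]; omega, hI⟩

theorem wp_markBalls (h : Setting w n m s tl hd d) (hσ : Ready w n m s tl hd σ) :
    WP w markBalls σ fun t τ => t ≤ n * s * 100 + 6 ∧
      ∀ a < n + n, τ.arr aHit a = 0 ↔
        σ.arr aHit a = 0 ∧ ¬∃ i < s, σ.arr aBall (a * s + i) = σ.var vMax := by
  have hw := h.one_lt
  have hb := h.word_bound
  have hsn := h.size_le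
  refine WP.mono (WP.forTo (B := n + n) (K := s * 22 + 6) (I := fun k τ =>
    ∀ a, τ.arr aHit a = 0 ↔ σ.arr aHit a = 0 ∧
      ¬(a < k ∧ ∃ i < s, σ.arr aBall (a * s + i) = σ.var vMax)) hw (by omega) (by decide) rfl rfl
    hσ.var_N (fun _ _ _ h => h) (by simp) ?_) ?_
  · intro k τ hk hF hva hI
    refine WP.mono (WP.forTo (B := s) (K := 14) (I := fun j υ =>
      ∀ a, υ.arr aHit a = 0 ↔ τ.arr aHit a = 0 ∧
        ¬(a = k ∧ ∃ i < j, σ.arr aBall (k * s + i) = σ.var vMax)) hw (by omega) (by decide) rfl rfl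
      ((hF.var vs rfl).trans hσ.var_s) (fun _ _ _ h => h) (by simp) ?_) ?_
    · intro j υ hj hG hvj hJ
      have hvs' : υ.var vs = s := ((hG.var vs rfl).trans (hF.var vs rfl)).trans hσ.var_s
      have hva' : υ.var va = k := (hG.var va rfl).trans hva
      have hball : υ.arr aBall = σ.arr aBall := (hG.arr aBall rfl).trans (hF.arr aBall rfl)
      have hmax : υ.var vMax = σ.var vMax := (hG.var vMax rfl).trans (hF.var vMax rfl)
      have hread : (Expr.read aBall cell(va, vj)).eval w υ = σ.arr aBall (k * s + j) :=
        eval_read (h.eval_cell hk hj hva' hvs' hvj) (by rw [hball])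
      refine WP.ite (fun he => ?_) (fun he => ?_)
      · rw [eval_eq_ne_zero hw, hread, eval_var hmax] at he
        refine WP.store (j := k) (v := 1) hva' (eval_const hw) ⟨by simp [Expr.cost], fun a => ?_⟩
        by_cases ha : a = k
        · subst ha
          simp only [setArr_arr_self, Function.update_self, one_ne_zero, false_iff]
          exact fun hc => hc.2 ⟨trivial, j, by omega, he⟩
        · simpa [ha] using hJ a
      · rw [eval_eq_eq_zero hw, hread, eval_var hmax] at he
        refine WP.skip ⟨by simp [Expr.cost], fun a => ?_⟩
        rw [hJ a]
        refine and_congr_right fun _ => not_congr (and_congr_right fun _ => ?_)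
        constructor
        · rintro ⟨i, hi, hx⟩
          exact ⟨i, by omega, hx⟩
        · rintro ⟨i, hi, hx⟩
          rcases Nat.lt_succ_iff_lt_or_eq.1 hi with hi | rfl
          · exact ⟨i, hi, hx⟩
          · exact absurd hx he
    · rintro t υ hG ⟨ht, hJ⟩
      refine ⟨by omega, fun a => ?_⟩
      rw [hJ a, hI a, and_assoc]
      refine and_congr_right fun _ => ?_
      by_cases ha : a = k
      · subst ha
        simp
      · have : a < k + 1 ↔ a < k := by omega
        simp [ha, this]
  · rintro t τ hF ⟨ht, hI⟩
    refine ⟨?_, fun a ha => by simpa [ha] using hI a⟩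
    have : n ≤ n * s := Nat.le_mul_of_pos_right _ h.size_pos
    have : (n + n) * (s * 22 + 6 + 8) = n * s * 44 + n * 28 := by ring
    omega

theorem Setting.dblDist_le (h : Setting w n m s tl hd d) {D a x : ℕ}
    (hD : ∀ u < n, ∀ v < n, d u v ≤ D) (ha : a < n + n) (hx : x ∈ comp n a) :
    dblDist n d a x ≤ D := by
  have hn := h.pos
  unfold dblDist
  rw [mem_comp] at hx
  split_ifs
  · exact hD _ (by omega) _ (by omega)
  · exact hD _ (by omega) _ (by omega)

theorem wp_measure (h : Setting w n m s tl hd d) (hσ : Ready w n m s tl hd σ) {D x : ℕ}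
    (hD : ∀ u < n, ∀ v < n, d u v ≤ D) (hvCap : σ.var vCap = n) (hvMax : σ.var vMax = x)
    (hx : x < n + n) (hbest : σ.var vBest ≤ D) :
    WP w measure σ fun t τ => t ≤ n * 80 + m * 80 + 70 ∧ τ.var vBest ≤ D ∧
      σ.var vBest ≤ τ.var vBest ∧ ∀ y ∈ comp n x, dblDist n d x y ≤ τ.var vBest := by
  have hw := h.one_lt
  have hb := h.word_bound
  have hn := h.pos
  refine WP.seq (WP.assign (v := x) hvMax ?_)
  refine WP.seq (WP.mono (wp_bfs (cap := n) (W := m + m) (N := n + n) hw (by omega)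
      (fun x hx => comp_lt hx) (h.distFrom hx) (hσ.rep x) (by simpa using hσ.var_N) (by simp)
      (by simpa using hvCap) (card_comp x).ge fun S _ _ => sum_dblDeg_le S) ?_)
  rintro t τ hF ⟨ht, hQ, hdist⟩
  have hlast := hQ.mem (i := n - 1) (by omega)
  have hlt : dblDist n d x (τ.arr aQueue (n - 1)) < n := by
    simpa [card_comp] using (h.distFrom hx).lt_card hlast
  have hbest' : τ.var vBest = σ.var vBest := hF.var vBest rfl
  have hle : ∀ y ∈ comp n x, dblDist n d x y ≤ dblDist n d x (τ.arr aQueue (n - 1)) :=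
    fun y hy => hQ.le_last (card_comp x) hy
  have hleD := h.dblDist_le hD hx hlast
  refine WP.seq (WP.assign (v := dblDist n d x (τ.arr aQueue (n - 1)))
    (eval_sub (x := dblDist n d x (τ.arr aQueue (n - 1)) + 1) (y := 1)
      (eval_read (j := τ.arr aQueue (n - 1)) (eval_read (j := n - 1)
        (eval_sub (x := n) (y := 1) (eval_var ((hF.var vn rfl).trans hσ.var_n)) (eval_const hw)
          (by omega)) rfl) (hdist _ (by omega))) (eval_const hw) (by omega)) ?_)
  refine WP.ite (fun he => ?_) (fun he => ?_)
  · rw [eval_lt_ne_zero hw, eval_var rfl, eval_var rfl] at he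
    simp only [setVar_var_self, ne_eq, Nat.reduceEqDiff, not_false_eq_true, setVar_var_ne, hbest']
      at he
    refine WP.assign (v := dblDist n d x (τ.arr aQueue (n - 1))) (eval_var (by simp)) ?_
    exact ⟨by simp only [Expr.cost]; omega, by simpa using hleD, by simpa using he.le,
      by simpa using hle⟩
  · rw [eval_lt_eq_zero hw, eval_var rfl, eval_var rfl] at he
    simp only [setVar_var_self, ne_eq, Nat.reduceEqDiff, not_false_eq_true, setVar_var_ne, hbest']
      at he
    refine WP.skip ⟨by simp only [Expr.cost]; omega, by simpa [hbest'] using hbest,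
      by simp [hbest'], fun y hy => ?_⟩
    simpa [hbest'] using (hle y hy).trans he

end

/-- The gain in the harmonic potential: a round that hits a fraction `s / N` of the balls pays for
itself. -/
theorem harmonic_gain {N s k k' g : ℕ} (hg : g ≠ 0) (h₁ : s * k ≤ N * g) (h₂ : g + k' ≤ k) :
    (N : ℚ) * harmonic k' + s ≤ N * harmonic k := by
  -- each of the terms `1 / i` with `k' < i ≤ k' + j` is at least `1 / (k' + j)`
  have gap : ∀ j : ℕ, ((j : ℚ) / (k' + j : ℕ)) + harmonic k' ≤ harmonic (k' + j) := by
    intro j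
    induction j with
    | zero => simp
    | succ j ih =>
      rw [← add_assoc, harmonic_succ]
      have hpos : (0 : ℚ) < (k' + j + 1 : ℕ) := by positivity
      have : ((j + 1 : ℕ) : ℚ) / (k' + j + 1 : ℕ) ≤
          (j : ℚ) / (k' + j : ℕ) + ((k' + j + 1 : ℕ) : ℚ)⁻¹ := by
        push_cast
        rw [add_div, one_div]
        refine add_le_add ?_ le_rfl
        rcases Nat.eq_zero_or_pos (k' + j) with h | h
        · obtain ⟨rfl, rfl⟩ : k' = 0 ∧ j = 0 := by omega
          simp
        · have : (0 : ℚ) < (k' : ℚ) + j := by exact_mod_cast h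
          exact div_le_div_of_nonneg_left (by positivity) this (by linarith)
      linarith
  have hk : (0 : ℚ) < k := by exact_mod_cast (show 0 < k by omega)
  have h := gap (k - k')
  rw [Nat.add_sub_cancel' (by omega : k' ≤ k)] at h
  have h₃ : (s : ℚ) ≤ N * (((k - k' : ℕ) : ℚ) / k) := by
    rw [mul_div_assoc', le_div_iff₀ hk]
    have : s * k ≤ N * (k - k') := h₁.trans (Nat.mul_le_mul_left _ (by omega))
    exact_mod_cast this
  have h₄ := mul_le_mul_of_nonneg_left h (Nat.cast_nonneg (α := ℚ) N)
  rw [mul_add] at h₄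
  linarith

section

variable {w n m s D : ℕ} {tl hd : ℕ → ℕ} {d : ℕ → ℕ → ℕ} {σ : State}

theorem wp_greedyRound (h : Setting w n m s tl hd d) (hσ : Ready w n m s tl hd σ)
    (hB : BallsUpTo n s d (n + n) (σ.arr aBall) (σ.arr aRad))
    (hD : ∀ u < n, ∀ v < n, d u v ≤ D) (hvCap : σ.var vCap = n) (hbest : σ.var vBest ≤ D)
    (hcov : ∀ a < n + n, σ.arr aHit a ≠ 0 → Covered n s d (σ.arr aBall) (σ.var vBest) a) :
    WP w greedyRound σ fun t τ => t ≤ n * s * 600 + m * 80 + 120 ∧ τ.var vBest ≤ D ∧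
      (∀ a < n + n, τ.arr aHit a ≠ 0 → Covered n s d (σ.arr aBall) (τ.var vBest) a) ∧
      s * unhit n (σ.arr aHit) ≤ (n + n) * τ.var vGo ∧
      τ.var vGo + unhit n (τ.arr aHit) ≤ unhit n (σ.arr aHit) := by
  refine WP.seq (WP.mono (wp_countBalls h hσ hB) ?_)
  rintro t₁ σ₁ hF₁ ⟨ht₁, hcount⟩
  have hσ₁ : Ready w n m s tl hd σ₁ := hσ.frame hF₁ rfl
  refine WP.seq (WP.mono (wp_findMax h hσ₁) ?_)
  rintro t₂ σ₂ hF₂ ⟨ht₂, hmaxN, hmax⟩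
  have hσ₂ : Ready w n m s tl hd σ₂ := hσ₁.frame hF₂ rfl
  refine WP.seq (WP.mono (wp_markBalls h hσ₂) ?_)
  rintro t₃ σ₃ hF₃ ⟨ht₃, hhit⟩
  have hσ₃ : Ready w n m s tl hd σ₃ := hσ₂.frame hF₃ rfl
  have hball₂ : σ₂.arr aBall = σ.arr aBall := (hF₂.arr aBall rfl).trans (hF₁.arr aBall rfl)
  have hhit₂ : σ₂.arr aHit = σ.arr aHit := (hF₂.arr aHit rfl).trans (hF₁.arr aHit rfl)
  have hbest₃ : σ₃.var vBest = σ.var vBest := by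
    rw [hF₃.var vBest rfl, hF₂.var vBest rfl, hF₁.var vBest rfl]
  rw [hball₂, hhit₂] at hhit
  refine WP.seq (WP.mono (wp_measure (x := σ₂.var vMax) h hσ₃ hD ?_ (hF₃.var vMax rfl) hmaxN
    (hbest₃.trans_le hbest)) ?_)
  · rw [hF₃.var vCap rfl, hF₂.var vCap rfl, hF₁.var vCap rfl, hvCap]
  rintro t₄ σ₄ hF₄ ⟨ht₄, hbest₄, hle, hecc⟩
  rw [hbest₃] at hle
  have hhit₄ : σ₄.arr aHit = σ₃.arr aHit := hF₄.arr aHit rfl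
  have hcnt : σ₄.arr aCount = σ₁.arr aCount := by
    rw [hF₄.arr aCount rfl, hF₃.arr aCount rfl, hF₂.arr aCount rfl]
  have hvm : σ₄.var vMax = σ₂.var vMax := by rw [hF₄.var vMax rfl, hF₃.var vMax rfl]
  refine WP.assign (v := count s (σ.arr aHit) (σ.arr aBall) (n + n) (σ₂.var vMax))
    (eval_read (eval_var hvm) (by rw [hcnt, hcount _ hmaxN])) ?_
  have hprog := greedy_progress (hit' := σ₃.arr aHit) hB
    (fun y hy => by simpa only [hcount y hy, hcount _ hmaxN] using hmax y hy) hhit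
  refine ⟨?_, by simpa using hbest₄, fun a ha hne => ?_, by simpa using hprog.1,
    by simpa [hhit₄] using hprog.2⟩
  · have : n ≤ n * s := Nat.le_mul_of_pos_right _ h.size_pos
    simp only [Expr.cost]
    omega
  · simp only [setVar_arr, hhit₄] at hne
    simp only [ne_eq, Nat.reduceEqDiff, not_false_eq_true, setVar_var_ne]
    rw [Ne, hhit a ha, not_and_or, not_not] at hne
    rcases hne with hne | ⟨i, hi, hx⟩
    · obtain ⟨i, hi, hy⟩ := hcov a ha hne
      exact ⟨i, hi, fun y hy' => (hy y hy').trans hle⟩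
    · refine ⟨i, hi, fun y hy => ?_⟩
      rw [hx]
      refine hecc y ?_
      have := (hB a ha).1.mem hi
      simp only [hx] at this
      rw [mem_comp] at this hy ⊢
      omega

/-- The greedy choice ends with a hitting set. The hypothesis on `F` says that `F` rounds exhaust the
harmonic potential of all `2 * n` balls, with one round to spare for noticing that nothing is
left. -/
theorem wp_greedy (h : Setting w n m s tl hd d) (hσ : Ready w n m s tl hd σ)
    (hB : BallsUpTo n s d (n + n) (σ.arr aBall) (σ.arr aRad))
    (hD : ∀ u < n, ∀ v < n, d u v ≤ D) (hbest : σ.var vBest ≤ D) (hhit : σ.arr aHit = fun _ => 0)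
    {F : ℕ} (hF : ((n + n : ℕ) : ℚ) * harmonic (n + n) + s ≤ s * F) :
    WP w greedy σ fun t τ => t ≤ F * (n * s * 600 + m * 80 + 130) + 10 ∧ τ.var vBest ≤ D ∧
      ∀ a < n + n, Covered n s d (σ.arr aBall) (τ.var vBest) a := by
  have hs : (0 : ℚ) < s := by exact_mod_cast h.size_pos
  refine WP.seq (WP.assign (v := n) (eval_var hσ.var_n) ?_)
  refine WP.seq (WP.assign (v := 1) (eval_const h.one_lt) ?_)
  refine WP.mono (WP.loop (I := fun T τ => τ.var vBest ≤ D ∧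
    (∀ a < n + n, τ.arr aHit a ≠ 0 → Covered n s d (σ.arr aBall) (τ.var vBest) a) ∧
    ∃ f : ℕ, T = f * (n * s * 600 + m * 80 + 130) + 4 ∧
      ((τ.var vGo = 0 ∧ unhit n (τ.arr aHit) = 0) ∨
        (τ.var vGo ≠ 0 ∧
          ((n + n : ℕ) : ℚ) * harmonic (unhit n (τ.arr aHit)) + s ≤ s * f)))
    (T := F * (n * s * 600 + m * 80 + 130) + 4) ?_ ?_ ?_) ?_
  · rintro T τ hG ⟨hb, hc, f, rfl, hf⟩ he
    have hball : τ.arr aBall = σ.arr aBall := hG.arr aBall rfl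
    have hrad : τ.arr aRad = σ.arr aRad := hG.arr aRad rfl
    have hτ : Ready w n m s tl hd τ := (hσ.congr
      (τ := (σ.setVar vCap n).setVar vGo 1) rfl rfl rfl rfl rfl rfl rfl).frame hG rfl
    simp only [Expr.eval] at he
    replace hf := (hf.resolve_left fun hc => he hc.1).2
    refine WP.mono (wp_greedyRound h hτ (by rwa [hball, hrad]) hD (hG.var vCap rfl) hb
      (by rwa [hball])) ?_
    rintro t υ hH ⟨ht, hb', hc', hp₁, hp₂⟩
    rw [hball] at hc'
    -- the potential is positive, so at least one round is still accounted for
    obtain ⟨f, rfl⟩ : ∃ f', f = f' + 1 := by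
      refine Nat.exists_eq_succ_of_ne_zero ?_
      rintro rfl
      have : (0 : ℚ) ≤ ((n + n : ℕ) : ℚ) * harmonic (unhit n (τ.arr aHit)) := by
        unfold harmonic
        positivity
      rw [Nat.cast_zero, mul_zero] at hf
      linarith
    refine ⟨_, ?_, hb', hc', f, rfl, ?_⟩
    · simp only [Expr.cost]
      rw [Nat.succ_mul]
      omega
    · by_cases hgo : υ.var vGo = 0
      · refine .inl ⟨hgo, ?_⟩
        rw [hgo, mul_zero, Nat.le_zero, mul_eq_zero] at hp₁
        have := hp₁.resolve_left (by have := h.size_pos; omega)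
        omega
      · refine .inr ⟨hgo, ?_⟩
        have := harmonic_gain hgo hp₁ hp₂
        push_cast at this hf ⊢
        linarith
  · rintro T τ ⟨hb, hc, f, rfl, hf⟩ he
    simp only [Expr.cost]
    omega
  · refine ⟨by simpa using hbest, by simp [hhit], F, rfl, .inr ⟨by simp, ?_⟩⟩
    have : unhit n (((σ.setVar vCap n).setVar vGo 1).arr aHit) = n + n := by
      simp [unhit, hhit]
    rwa [this]
  · rintro t τ hG ⟨ht, he, T, hb, hc, f, -, hf⟩
    refine ⟨by simp only [Expr.cost]; omega, hb, fun a ha => hc a ha ?_⟩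
    simp only [Expr.eval] at he
    -- a round without progress means that all balls have been hit
    have hf := hf.resolve_right fun hc => hc.1 he
    exact Finset.filter_eq_empty_iff.1 (Finset.card_eq_zero.1 hf.2) (x := a) (by simpa using ha)

end

/-! ### Pairs of balls -/

/-- Raise the estimate to the lower bound on the distance from `va` to `vb` that follows from the
ball around `va` and the reversed ball around `vb`. -/
def pairEst : Program :=
  vz ::= .var vn ⊞ .var vb ;;
  vEst ::= .read aRad (.var va ⊠ .var vs ⊞ (.var vs ⊟ .const 1)) ⊞
    .read aRad (.var vz ⊠ .var vs ⊞ (.var vs ⊟ .const 1)) ;;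
  forTo vi vs
    (forTo vj vs
      (.ite (.read aAdj (.read aBall cell(va, vi) ⊠ .var vn ⊞
          (.read aBall cell(vz, vj) ⊟ .var vn)))
        (vCand ::= .read aRad cell(va, vi) ⊞ .const 1 ⊞ .read aRad cell(vz, vj) ;;
         .ite (.var vCand ≺ .var vEst) (vEst ::= .var vCand) .skip)
        .skip)) ;;
  .ite (.var vBest ≺ .var vEst) (vBest ::= .var vEst) .skip

/-- Treat all pairs of different vertices. -/
def pairs : Program :=
  forTo va vn (forTo vb vn (.ite (.var va ≐ .var vb) .skip pairEst))

section

variable {w n m s D : ℕ} {tl hd : ℕ → ℕ} {d : ℕ → ℕ → ℕ} {σ : State}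

theorem GraphDist.exists_between {A : ℕ → ℕ → Prop} (h : GraphDist n A d) {u v : ℕ} (hu : u < n)
    (hv : v < n) {k : ℕ} (hk : k ≤ d u v) : ∃ x < n, d u x = k ∧ d x v = d u v - k := by
  induction k with
  | zero => exact ⟨u, hu, (h.zero hu hu).2 rfl, rfl⟩
  | succ k ih =>
    obtain ⟨x, hx, hux, hxv⟩ := ih (by omega)
    obtain ⟨y, hy, hA, hyv⟩ := h.succ (k := d u v - (k + 1)) hx hv (by omega)
    refine ⟨y, hy, ?_, hyv⟩
    have h₁ := h.triangle hu hx hy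
    have h₂ := h.adj hA
    have h₃ := h.triangle hu hy hv
    omega

/-- A list of closest vertices from `u` contains `u` even if its last distance is `0`. -/
theorem Closest.exists_eq {E : ℕ → ℕ → Prop} {V : Finset ℕ} {u : ℕ} {δ Q : ℕ → ℕ}
    (h : Closest V δ s Q) (hD : DistFrom E V u δ) (hs : 1 ≤ s) {y : ℕ} (hy : y ∈ V)
    (hlt : δ y < δ (Q (s - 1)) ∨ δ y = 0) : ∃ i < s, Q i = y := by
  by_cases h' : δ y < δ (Q (s - 1))
  · exact h.complete hy (by omega) h'
  · refine ⟨0, hs, ?_⟩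
    have h₁ := h.mono (i := 0) (j := s - 1) (by omega) (by omega)
    rw [(hD.zero hy).1 (by omega), ← hD.zero (h.mem hs)]
    omega

/-- The lower bound obtained from a pair of balls does not exceed the distance: if the distance is
less than the sum of the radii, then a shortest path has an arc from one ball to the other. -/
theorem estimate_le (h : Setting w n m s tl hd d) {ball rad : ℕ → ℕ}
    (hB : BallsUpTo n s d (n + n) ball rad) {u v e : ℕ} (hu : u < n) (hv : v < n) (huv : u ≠ v)
    (he₁ : e ≤ rad (u * s + (s - 1)) + rad ((n + v) * s + (s - 1)))
    (he₂ : ∀ i < s, ∀ j < s, ArcAdj m tl hd (ball (u * s + i)) (ball ((n + v) * s + j) - n) →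
      e ≤ rad (u * s + i) + 1 + rad ((n + v) * s + j)) : e ≤ d u v := by
  have hs := h.size_pos
  obtain ⟨hC, hR⟩ := hB u (by omega)
  obtain ⟨hC', hR'⟩ := hB (n + v) (by omega)
  have hL : d u v ≠ 0 := fun h0 => huv ((h.dist.zero hu hv).1 h0)
  have hdu : ∀ x, dblDist n d u x = d u x := fun x => if_pos hu
  have hdv : ∀ x, dblDist n d (n + v) (n + x) = d x v := fun x => by
    rw [dblDist, if_neg (by omega), Nat.add_sub_cancel_left, Nat.add_sub_cancel_left]
  set r := rad (u * s + (s - 1)) with hr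
  set r' := rad ((n + v) * s + (s - 1)) with hr'
  rcases Nat.lt_or_ge (d u v) (r + r') with hlt | hge
  · -- split a shortest path at an arc whose ends lie in the two balls; a ball of radius `0` holds
    -- only its centre, whence the truncated subtractions
    obtain ⟨x, hx, hux, hxv⟩ := h.dist.exists_between hu hv (k := min (r - 1) (d u v - 1))
      (by omega)
    obtain ⟨y, hy, hA, hyv⟩ := h.dist.succ (k := d u v - min (r - 1) (d u v - 1) - 1) hx hv
      (by omega)
    obtain ⟨i, hi, hix⟩ := hC.exists_eq (h.distFrom (by omega)) hs (y := x)
      (mem_comp.2 (.inl ⟨hu, hx⟩)) (by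
        rw [← hR (s - 1) (by omega), hdu, hux]
        omega)
    obtain ⟨j, hj, hjy⟩ := hC'.exists_eq (h.distFrom (by omega)) hs (y := n + y)
      (mem_comp.2 (.inr ⟨by omega, by omega, by omega⟩)) (by
        rw [← hR' (s - 1) (by omega), hdv, hyv]
        omega)
    have := he₂ i hi j hj (by rw [hix, hjy, Nat.add_sub_cancel_left]; exact hA)
    rw [hR i hi, hR' j hj, hix, hjy, hdu, hdv] at this
    omega
  · omega

/-- The value computed for a pair is at most the distance, and it is at least the smaller one of the
distance and the sum of the radii. -/
theorem wp_pairEst (h : Setting w n m s tl hd d) (hσ : Ready w n m s tl hd σ)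
    (hB : BallsUpTo n s d (n + n) (σ.arr aBall) (σ.arr aRad)) {u v : ℕ} (hu : u < n) (hv : v < n)
    (huv : u ≠ v) (hva : σ.var va = u) (hvb : σ.var vb = v) :
    WP w pairEst σ fun t τ => t ≤ s * s * 100 + 50 ∧ σ.var vBest ≤ τ.var vBest ∧
      min (σ.arr aRad (u * s + (s - 1)) + σ.arr aRad ((n + v) * s + (s - 1))) (d u v) ≤
        τ.var vBest ∧
      τ.var vBest ≤ max (σ.var vBest) (d u v) := by
  have hw := h.one_lt
  have hb := h.word_bound
  have hsn := h.size_le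
  have hs := h.size_pos
  obtain ⟨hC, hR⟩ := hB u (by omega)
  obtain ⟨hC', hR'⟩ := hB (n + v) (by omega)
  have hmem : ∀ i < s, σ.arr aBall (u * s + i) < n := fun i hi => by
    have := hC.mem hi
    rw [mem_comp] at this
    omega
  have hmem' : ∀ j < s, n ≤ σ.arr aBall ((n + v) * s + j) ∧
      σ.arr aBall ((n + v) * s + j) < n + n := fun j hj => by
    have := hC'.mem hj
    rw [mem_comp] at this
    omega
  have hdu : ∀ i < s, σ.arr aRad (u * s + i) = d u (σ.arr aBall (u * s + i)) := fun i hi => by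
    rw [hR i hi, dblDist, if_pos hu]
  have hdv : ∀ j < s, σ.arr aRad ((n + v) * s + j) = d (σ.arr aBall ((n + v) * s + j) - n) v :=
    fun j hj => by rw [hR' j hj, dblDist, if_neg (by omega), Nat.add_sub_cancel_left]
  have hlt : ∀ i < s, σ.arr aRad (u * s + i) < n := fun i hi => by
    rw [hR i hi]
    simpa [card_comp] using (h.distFrom (a := u) (by omega)).lt_card (hC.mem hi)
  have hlt' : ∀ j < s, σ.arr aRad ((n + v) * s + j) < n := fun j hj => by
    rw [hR' j hj]
    simpa [card_comp] using (h.distFrom (a := n + v) (by omega)).lt_card (hC'.mem hj)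
  set r := σ.arr aRad (u * s + (s - 1)) with hr
  set r' := σ.arr aRad ((n + v) * s + (s - 1)) with hr'
  have hrn : r < n := hlt _ (by omega)
  have hrn' : r' < n := hlt' _ (by omega)
  refine WP.seq (WP.assign (v := n + v)
    (eval_add (eval_var hσ.var_n) (eval_var hvb) (by omega)) ?_)
  have hvs : (σ.setVar vz (n + v)).var vs = s := by simpa using hσ.var_s
  have hlast : (Expr.var vs ⊟ .const 1).eval w (σ.setVar vz (n + v)) = s - 1 :=
    eval_sub (eval_var hvs) (eval_const hw) (by omega)
  have hc := h.cell_lt (a := u) (i := s - 1) (by omega) (by omega)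
  have hc' := h.cell_lt (a := n + v) (i := s - 1) (by omega) (by omega)
  refine WP.seq (WP.assign (v := r + r') (eval_add
    (eval_read (eval_add (eval_mul (eval_var (by simpa using hva)) (eval_var hvs) (by omega))
      hlast (by omega)) rfl)
    (eval_read (eval_add (eval_mul (eval_var (by simp)) (eval_var hvs) (by omega))
      hlast (by omega)) rfl) (by omega)) ?_)
  refine WP.seq (WP.mono (WP.forTo (B := s) (K := s * 68 + 6) (I := fun k τ =>
    τ.var vEst ≤ r + r' ∧ min (r + r') (d u v) ≤ τ.var vEst ∧
    ∀ i < k, ∀ j < s,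
      ArcAdj m tl hd (σ.arr aBall (u * s + i)) (σ.arr aBall ((n + v) * s + j) - n) →
      τ.var vEst ≤ σ.arr aRad (u * s + i) + 1 + σ.arr aRad ((n + v) * s + j))
    hw (by omega) (by decide) rfl rfl hvs (fun _ _ _ h => h) (by simp) ?_) ?_)
  · rintro i τ hi hF hvi ⟨hI₁, hI₂, hI₃⟩
    refine WP.mono (WP.forTo (B := s) (K := 60) (I := fun k υ =>
      υ.var vEst ≤ τ.var vEst ∧ min (r + r') (d u v) ≤ υ.var vEst ∧
      ∀ j < k,
        ArcAdj m tl hd (σ.arr aBall (u * s + i)) (σ.arr aBall ((n + v) * s + j) - n) →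
        υ.var vEst ≤ σ.arr aRad (u * s + i) + 1 + σ.arr aRad ((n + v) * s + j))
      hw (by omega) (by decide) rfl rfl ((hF.var vs rfl).trans hvs) (fun _ _ _ h => h)
      ⟨le_rfl, hI₂, by simp⟩ ?_) ?_
    · rintro j υ hj hG hvj ⟨hJ₁, hJ₂, hJ₃⟩
      have hvs' : υ.var vs = s := ((hG.var vs rfl).trans (hF.var vs rfl)).trans hvs
      have hvn' : υ.var vn = n := ((hG.var vn rfl).trans (hF.var vn rfl)).trans
        (by simpa using hσ.var_n)
      have hva' : υ.var va = u := ((hG.var va rfl).trans (hF.var va rfl)).trans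
        (by simpa using hva)
      have hvz' : υ.var vz = n + v := ((hG.var vz rfl).trans (hF.var vz rfl)).trans (by simp)
      have hvi' : υ.var vi = i := (hG.var vi rfl).trans hvi
      have hball : υ.arr aBall = σ.arr aBall := (hG.arr aBall rfl).trans (hF.arr aBall rfl)
      have hrad : υ.arr aRad = σ.arr aRad := (hG.arr aRad rfl).trans (hF.arr aRad rfl)
      have hadj : υ.arr aAdj = σ.arr aAdj := (hG.arr aAdj rfl).trans (hF.arr aAdj rfl)
      have hcell := h.eval_cell (σ := υ) (by omega) hi hva' hvs' hvi'
      have hcell' := h.eval_cell (σ := υ) (by omega) hj hvz' hvs' hvj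
      have hx := hmem i hi
      have hy := hmem' j hj
      have hprod : σ.arr aBall (u * s + i) * n ≤ n * n := Nat.mul_le_mul_right _ hx.le
      have hcond : (Expr.read aAdj (.read aBall cell(va, vi) ⊠ .var vn ⊞
          (.read aBall cell(vz, vj) ⊟ .var vn))).eval w υ =
          σ.arr aAdj (σ.arr aBall (u * s + i) * n + (σ.arr aBall ((n + v) * s + j) - n)) :=
        eval_read (eval_add (eval_mul (eval_read hcell (by rw [hball])) (eval_var hvn') (by omega))
          (eval_sub (eval_read hcell' (by rw [hball])) (eval_var hvn') (by omega)) (by omega))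
          (by rw [hadj])
      have hmat := hσ.matrix _ hx (σ.arr aBall ((n + v) * s + j) - n) (by omega)
      refine WP.ite (fun he => ?_) (fun he => ?_)
      · rw [hcond, hmat] at he
        -- a path through this arc joins the two vertices
        have hpath : d u v ≤ σ.arr aRad (u * s + i) + 1 + σ.arr aRad ((n + v) * s + j) := by
          have h₁ := h.dist.triangle (x := v) hu hx hv
          have h₂ := h.dist.triangle (x := v) (v := σ.arr aBall ((n + v) * s + j) - n) hx
            (by omega) hv
          have h₃ := h.dist.adj he
          rw [hdu i hi, hdv j hj]
          omega
        have hri := hlt i hi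
        have hrj := hlt' j hj
        refine WP.seq (WP.assign
          (v := σ.arr aRad (u * s + i) + 1 + σ.arr aRad ((n + v) * s + j))
          (eval_add (eval_add (eval_read hcell (by rw [hrad])) (eval_const hw) (by omega))
            (eval_read hcell' (by rw [hrad])) (by omega)) ?_)
        refine WP.ite (fun he' => ?_) (fun he' => ?_)
        · rw [eval_lt_ne_zero hw, eval_var rfl, eval_var rfl] at he'
          simp only [setVar_var_self, ne_eq, Nat.reduceEqDiff, not_false_eq_true, setVar_var_ne]
            at he'
          refine WP.assign (v := σ.arr aRad (u * s + i) + 1 + σ.arr aRad ((n + v) * s + j))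
            (eval_var (by simp)) ⟨by simp [Expr.cost], ?_⟩
          simp only [setVar_var_self]
          refine ⟨by omega, by omega, fun j' hj' hA => ?_⟩
          rcases Nat.lt_succ_iff_lt_or_eq.1 hj' with hj' | rfl
          · exact he'.le.trans (hJ₃ j' hj' hA)
          · exact le_rfl
        · rw [eval_lt_eq_zero hw, eval_var rfl, eval_var rfl] at he'
          simp only [setVar_var_self, ne_eq, Nat.reduceEqDiff, not_false_eq_true, setVar_var_ne]
            at he'
          refine WP.skip ⟨by simp [Expr.cost], ?_⟩
          simp only [ne_eq, Nat.reduceEqDiff, not_false_eq_true, setVar_var_ne]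
          refine ⟨hJ₁, hJ₂, fun j' hj' hA => ?_⟩
          rcases Nat.lt_succ_iff_lt_or_eq.1 hj' with hj' | rfl
          · exact hJ₃ j' hj' hA
          · exact he'
      · rw [hcond] at he
        refine WP.skip ⟨by simp [Expr.cost], hJ₁, hJ₂, fun j' hj' hA => ?_⟩
        rcases Nat.lt_succ_iff_lt_or_eq.1 hj' with hj' | rfl
        · exact hJ₃ j' hj' hA
        · exact absurd he (hmat.2 hA)
    · rintro t υ hG ⟨ht, hJ₁, hJ₂, hJ₃⟩
      refine ⟨by omega, hJ₁.trans hI₁, hJ₂, fun i' hi' j hj hA => ?_⟩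
      rcases Nat.lt_succ_iff_lt_or_eq.1 hi' with hi' | rfl
      · exact hJ₁.trans (hI₃ i' hi' j hj hA)
      · exact hJ₃ j hj hA
  · rintro t τ hF ⟨ht, hI₁, hI₂, hI₃⟩
    have hle := estimate_le h hB hu hv huv hI₁ hI₃
    have hbest : τ.var vBest = σ.var vBest := (hF.var vBest rfl).trans (by simp)
    have htime : s * (s * 68 + 6 + 8) ≤ s * s * 82 := by nlinarith
    refine WP.ite (fun he => ?_) (fun he => ?_)
    · rw [eval_lt_ne_zero hw, eval_var rfl, eval_var rfl, hbest] at he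
      refine WP.assign (v := τ.var vEst) rfl ⟨by simp only [Expr.cost]; omega, ?_⟩
      simp only [setVar_var_self]
      exact ⟨he.le, hI₂, hle.trans (le_max_right _ _)⟩
    · rw [eval_lt_eq_zero hw, eval_var rfl, eval_var rfl, hbest] at he
      refine WP.skip ⟨by simp only [Expr.cost]; omega, ?_⟩
      rw [hbest]
      exact ⟨le_rfl, hI₂.trans he, le_max_left _ _⟩

theorem wp_pairs (h : Setting w n m s tl hd d) (hσ : Ready w n m s tl hd σ)
    (hB : BallsUpTo n s d (n + n) (σ.arr aBall) (σ.arr aRad))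
    (hD : ∀ u < n, ∀ v < n, d u v ≤ D) (hbest : σ.var vBest ≤ D) :
    WP w pairs σ fun t τ => t ≤ n * n * (s * s) * 200 + 10 ∧ τ.var vBest ≤ D ∧
      σ.var vBest ≤ τ.var vBest ∧ ∀ u < n, ∀ v < n, u ≠ v →
        min (σ.arr aRad (u * s + (s - 1)) + σ.arr aRad ((n + v) * s + (s - 1))) (d u v) ≤
          τ.var vBest := by
  have hw := h.one_lt
  have hb := h.word_bound
  have hsn := h.size_le
  set f : ℕ → ℕ → ℕ := fun u v =>
    min (σ.arr aRad (u * s + (s - 1)) + σ.arr aRad ((n + v) * s + (s - 1))) (d u v) with hf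
  refine WP.mono (WP.forTo (B := n) (K := n * (s * s * 100 + 68) + 6) (I := fun k τ =>
    τ.var vBest ≤ D ∧ σ.var vBest ≤ τ.var vBest ∧
    ∀ u < k, ∀ v < n, u ≠ v → f u v ≤ τ.var vBest) hw (by omega) (by decide) rfl rfl
    hσ.var_n (fun _ _ _ h => h) ⟨hbest, le_rfl, by simp⟩ ?_) ?_
  · rintro u τ hu hF hva ⟨hI₁, hI₂, hI₃⟩
    refine WP.mono (WP.forTo (B := n) (K := s * s * 100 + 60) (I := fun k υ =>
      υ.var vBest ≤ D ∧ τ.var vBest ≤ υ.var vBest ∧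
      ∀ v < k, u ≠ v → f u v ≤ υ.var vBest) hw (by omega) (by decide) rfl rfl
      ((hF.var vn rfl).trans hσ.var_n) (fun _ _ _ h => h) ⟨hI₁, le_rfl, by simp⟩ ?_) ?_
    · rintro v υ hv hG hvb ⟨hJ₁, hJ₂, hJ₃⟩
      have hva' : υ.var va = u := (hG.var va rfl).trans hva
      have hball : υ.arr aBall = σ.arr aBall := (hG.arr aBall rfl).trans (hF.arr aBall rfl)
      have hrad : υ.arr aRad = σ.arr aRad := (hG.arr aRad rfl).trans (hF.arr aRad rfl)
      refine WP.ite (fun he => ?_) (fun he => ?_)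
      · rw [eval_eq_ne_zero hw, eval_var hva', eval_var hvb] at he
        refine WP.skip ⟨by simp only [Expr.cost]; omega, hJ₁, hJ₂, fun v' hv' hne => ?_⟩
        exact hJ₃ v' (by omega) hne
      · rw [eval_eq_eq_zero hw, eval_var hva', eval_var hvb] at he
        refine WP.mono (wp_pairEst h ((hσ.frame hF rfl).frame hG rfl) (by rwa [hball, hrad]) hu hv
          he hva' hvb) ?_
        rintro t φ hH ⟨ht, h₁, h₂, h₃⟩
        rw [hrad] at h₂
        refine ⟨by simp only [Expr.cost]; omega, h₃.trans (max_le hJ₁ (hD u hu v hv)),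
          hJ₂.trans h₁, fun v' hv' hne => ?_⟩
        rcases Nat.lt_succ_iff_lt_or_eq.1 hv' with hv' | rfl
        · exact (hJ₃ v' hv' hne).trans h₁
        · exact h₂
    · rintro t υ hG ⟨ht, hJ₁, hJ₂, hJ₃⟩
      refine ⟨by omega, hJ₁, hI₂.trans hJ₂, fun u' hu' v hv hne => ?_⟩
      rcases Nat.lt_succ_iff_lt_or_eq.1 hu' with hu' | rfl
      · exact (hI₃ u' hu' v hv hne).trans hJ₂
      · exact hJ₃ v hv hne
  · rintro t τ hF ⟨ht, hI⟩
    refine ⟨?_, hI⟩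
    have h₁ : n * n ≤ n * n * (s * s) :=
      Nat.le_mul_of_pos_right _ (Nat.mul_pos h.size_pos h.size_pos)
    have h₂ : n ≤ n * n := Nat.le_mul_of_pos_left _ h.pos
    have : n * (n * (s * s * 100 + 68) + 6 + 8) = n * n * (s * s) * 100 + n * n * 68 + n * 14 := by
      ring
    omega

/-- If both balls at the ends of a longest shortest path are deep, their pair yields a good
estimate. Otherwise a vertex of the hitting set is close to one of the ends. -/
theorem estimate_ge (h : Setting w n m s tl hd d) {ball rad : ℕ → ℕ} {best : ℕ}
    (hB : BallsUpTo n s d (n + n) ball rad)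
    (hcov : ∀ a < n + n, Covered n s d ball best a)
    (hpair : ∀ u < n, ∀ v < n, u ≠ v →
      min (rad (u * s + (s - 1)) + rad ((n + v) * s + (s - 1))) (d u v) ≤ best)
    {a b l z : ℕ} (ha : a < n) (hb : b < n) (hz : z ≤ 2) (hab : d a b = 3 * l + z) :
    2 * l + z ≤ best := by
  by_cases hne : a = b
  · have := (h.dist.zero ha hb).2 hne
    omega
  obtain ⟨hC, hR⟩ := hB a (by omega)
  obtain ⟨hC', hR'⟩ := hB (n + b) (by omega)
  have hs := h.size_pos
  obtain ⟨i, hi, hecc⟩ := hcov a (by omega)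
  obtain ⟨j, hj, hecc'⟩ := hcov (n + b) (by omega)
  have hp := hpair a ha b hb hne
  have hx := hC.mem hi
  have hy := hC'.mem hj
  simp only [mem_comp] at hx hy
  -- the path from `a` to `b` through the chosen vertex in the ball of `a`
  have h₁ : 3 * l + z ≤ rad (a * s + (s - 1)) + best := by
    have e₁ := hecc b (mem_comp.2 (.inl ⟨ha, hb⟩))
    have e₂ := hC.mono (i := i) (j := s - 1) (by omega) (by omega)
    simp only [← hR (s - 1) (by omega)] at e₂
    rw [dblDist, if_pos (by omega)] at e₁ e₂
    have := h.dist.triangle (v := ball (a * s + i)) ha (by omega) hb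
    omega
  -- the path through the chosen vertex in the reversed ball of `b`
  have h₂ : 3 * l + z ≤ rad ((n + b) * s + (s - 1)) + best := by
    have e₁ := hecc' (n + a) (mem_comp.2 (.inr ⟨by omega, by omega, by omega⟩))
    have e₂ := hC'.mono (i := j) (j := s - 1) (by omega) (by omega)
    simp only [← hR' (s - 1) (by omega)] at e₂
    rw [dblDist, if_neg (by omega), Nat.add_sub_cancel_left] at e₁ e₂
    have := h.dist.triangle (v := ball ((n + b) * s + j) - n) ha (by omega) hb
    omega
  omega

end

/-! ### The algorithm -/

/-- The approximation algorithm for the diameter. -/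
def diameter : Program := prepare ;; balls ;; greedy ;; pairs ;; vn ::= .var vBest

/-- A bound for the number of steps of the algorithm with balls of size `s` and at most `F` rounds
of the greedy choice. -/
def steps (n m s F : ℕ) : ℕ :=
  n * 30 + m * 100 + n * n * s * 600 + F * (n * s * 600 + m * 80 + 130) +
    n * n * (s * s) * 200 + 150

section

variable {w n m D : ℕ} {tl hd : ℕ → ℕ} {d : ℕ → ℕ → ℕ} {σ : State}

theorem wp_diameter (h : Setting w n m 1 tl hd d) (hvn : σ.var vn = n) (hvm : σ.var vm = m)
    (htl : σ.arr aTail = tl) (hhd : σ.arr aTip = hd) (hadj : σ.arr aAdj = fun _ => 0)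
    (hfirst : σ.arr aFirst = fun _ => 0) (hhit : σ.arr aHit = fun _ => 0)
    (hbest : σ.var vBest = 0) (hD : ∀ u < n, ∀ v < n, d u v ≤ D) {a b l z : ℕ} (ha : a < n)
    (hb : b < n) (hz : z ≤ 2) (hab : d a b = 3 * l + z) :
    WP w diameter σ fun t τ => (∃ s F : ℕ, 1 ≤ s ∧ s ≤ n ∧ (s = 1 ∨ s ^ 3 * n ≤ m) ∧
      m < (s + 1) ^ 3 * n ∧ (s * F : ℚ) ≤ (n + n : ℕ) * harmonic (n + n) + 2 * s ∧
      t ≤ steps n m s F) ∧ 2 * l + z ≤ τ.var vn ∧ τ.var vn ≤ D := by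
  refine WP.seq (WP.mono (wp_prepare h hvn hvm (fun i _ => congrFun htl i)
    (fun i _ => congrFun hhd i) hadj hfirst) ?_)
  rintro t₁ σ₁ hF₁ ⟨ht₁, s, hs, hs₁, hs₂, hσ₁⟩
  have hspos : (0 : ℚ) < s := by exact_mod_cast hs.size_pos
  obtain ⟨F, hF, hF'⟩ : ∃ F : ℕ, ((n + n : ℕ) : ℚ) * harmonic (n + n) + s ≤ s * F ∧
      (s * F : ℚ) ≤ (n + n : ℕ) * harmonic (n + n) + 2 * s := by
    set q : ℚ := ((n + n : ℕ) : ℚ) * harmonic (n + n) + s with hq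
    have hq0 : 0 ≤ q := by
      rw [hq]
      unfold harmonic
      positivity
    refine ⟨⌈q / s⌉₊, ?_, ?_⟩
    · rw [← div_le_iff₀' hspos]
      exact Nat.le_ceil _
    · have := mul_le_mul_of_nonneg_left (Nat.ceil_lt_add_one (div_nonneg hq0 hspos.le)).le hspos.le
      rw [mul_add, mul_div_cancel₀ _ hspos.ne'] at this
      linarith
  refine WP.seq (WP.mono (wp_balls hs hσ₁) ?_)
  rintro t₂ σ₂ hF₂ ⟨ht₂, hB⟩
  have hσ₂ : Ready w n m s tl hd σ₂ := hσ₁.frame hF₂ rfl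
  refine WP.seq (WP.mono (wp_greedy hs hσ₂ hB hD ?_ ?_ hF) ?_)
  · rw [hF₂.var vBest rfl, hF₁.var vBest rfl, hbest]
    exact Nat.zero_le _
  · rw [hF₂.arr aHit rfl, hF₁.arr aHit rfl, hhit]
  rintro t₃ σ₃ hF₃ ⟨ht₃, hb₃, hcov⟩
  have hσ₃ : Ready w n m s tl hd σ₃ := hσ₂.frame hF₃ rfl
  have hball : σ₃.arr aBall = σ₂.arr aBall := hF₃.arr aBall rfl
  have hrad : σ₃.arr aRad = σ₂.arr aRad := hF₃.arr aRad rfl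
  refine WP.seq (WP.mono (wp_pairs hs hσ₃ (by rwa [hball, hrad]) hD hb₃) ?_)
  rintro t₄ σ₄ hF₄ ⟨ht₄, hb₄, hle, hpair⟩
  rw [hrad] at hpair
  refine WP.assign (v := σ₄.var vBest) rfl ⟨⟨s, F, hs.size_pos, hs.size_le, hs₁, hs₂, hF', ?_⟩,
    ?_, by simpa using hb₄⟩
  · simp only [Expr.cost, steps]
    rw [mul_add] at ht₃ ⊢
    omega
  · rw [setVar_var_self]
    refine estimate_ge hs hB (fun a ha => ?_) hpair ha hb hz hab
    obtain ⟨i, hi, hy⟩ := hcov a ha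
    exact ⟨i, hi, fun y hy' => (hy y hy').trans hle⟩

end

/-! ### The running time -/

/-- The time for the pairs of balls is within the bound, as `s` is at most `(m / n) ^ (1 / 3)`. -/
theorem sq_mul_sq_le {n m s : ℕ} (h : s ^ 3 * n ≤ m) :
    (n : ℝ) ^ 2 * s ^ 2 ≤ (m : ℝ) ^ (2 / 3 : ℝ) * (n : ℝ) ^ (4 / 3 : ℝ) := by
  have h' : (s : ℝ) ^ 3 * n ≤ m := by exact_mod_cast h
  have h₁ := Real.rpow_le_rpow (by positivity) h' (by norm_num : (0 : ℝ) ≤ 2 / 3)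
  have h₂ := mul_le_mul_of_nonneg_right h₁ (by positivity : (0 : ℝ) ≤ (n : ℝ) ^ (4 / 3 : ℝ))
  refine le_trans (le_of_eq ?_) h₂
  rw [Real.mul_rpow (by positivity) (by positivity), mul_assoc,
    ← Real.rpow_add_of_nonneg (by positivity) (by norm_num) (by norm_num), ← Real.rpow_natCast,
    ← Real.rpow_natCast, ← Real.rpow_natCast, ← Real.rpow_mul (by positivity)]
  norm_num
  ring

/-- The time for `n / s` searches is within the bound, as `s` is at least half of
`(m / n) ^ (1 / 3)`. -/
theorem mul_le_size_mul {n m s : ℕ} (hs : 1 ≤ s) (h : m < (s + 1) ^ 3 * n) :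
    (m : ℝ) * n ≤ 2 * s * ((m : ℝ) ^ (2 / 3 : ℝ) * (n : ℝ) ^ (4 / 3 : ℝ)) := by
  have hm : m ≤ (2 * s) ^ 3 * n :=
    h.le.trans (Nat.mul_le_mul_right _ (Nat.pow_le_pow_left (by omega) 3))
  have hm' : (m : ℝ) ≤ (2 * s) ^ 3 * n := by exact_mod_cast hm
  have h₁ := Real.rpow_le_rpow (by positivity) hm' (by norm_num : (0 : ℝ) ≤ 1 / 3)
  rw [Real.mul_rpow (by positivity) (by positivity), ← Real.rpow_natCast (2 * (s : ℝ)),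
    ← Real.rpow_mul (by positivity)] at h₁
  have hm₃ : (m : ℝ) = (m : ℝ) ^ (2 / 3 : ℝ) * (m : ℝ) ^ (1 / 3 : ℝ) := by
    rw [← Real.rpow_add_of_nonneg (by positivity) (by norm_num) (by norm_num)]
    norm_num
  have hn₃ : (n : ℝ) ^ (4 / 3 : ℝ) = (n : ℝ) ^ (1 / 3 : ℝ) * n := by
    rw [← Real.rpow_add_one' (by positivity) (by norm_num)]
    norm_num
  norm_num at h₁
  calc (m : ℝ) * n = (m : ℝ) ^ (2 / 3 : ℝ) * (m : ℝ) ^ (1 / 3 : ℝ) * n := by rw [← hm₃]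
    _ ≤ (m : ℝ) ^ (2 / 3 : ℝ) * (2 * s * (n : ℝ) ^ (1 / 3 : ℝ)) * n := by
      gcongr
    _ = _ := by rw [hn₃]; ring

/-- The number of steps is `O(m ^ (2 / 3) * n ^ (4 / 3) * log n + 1)`. -/
theorem steps_le {n m s F : ℕ} (hn : 0 < n) (hmn : m ≤ n * n) (hm : n = 1 ∨ n ≤ m)
    (hs : 1 ≤ s) (hsn : s ≤ n) (h₁ : s = 1 ∨ s ^ 3 * n ≤ m) (h₂ : m < (s + 1) ^ 3 * n)
    (hF : (s * F : ℚ) ≤ (n + n : ℕ) * harmonic (n + n) + 2 * s) :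
    (steps n m s F : ℝ) ≤
      50000 * ((m : ℝ) ^ (2 / 3 : ℝ) * (n : ℝ) ^ (4 / 3 : ℝ) * Real.log n + 1) := by
  have hharm : ((harmonic (n + n) : ℚ) : ℝ) ≤ 1 + Real.log ((n + n : ℕ) : ℝ) :=
    harmonic_le_one_add_log _
  have hn0 : (1 : ℝ) ≤ n := by exact_mod_cast hn
  have hlog : Real.log ((n + n : ℕ) : ℝ) = Real.log 2 + Real.log n := by
    rw [← Real.log_mul (by norm_num) (by positivity)]
    push_cast
    ring_nf
  have hl2 := Real.log_two_lt_d9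
  have hl2' := Real.log_two_gt_d9
  have hln : 0 ≤ Real.log n := Real.log_nonneg hn0
  set L : ℝ := 2 + Real.log n with hL
  have hs0 : (1 : ℝ) ≤ s := by exact_mod_cast hs
  have hsn0 : (s : ℝ) ≤ n := by exact_mod_cast hsn
  have hF₀ : (s * F : ℝ) ≤ 2 * n * L + 2 * s := by
    have hF' : (s * F : ℝ) ≤ (n + n : ℕ) * ((harmonic (n + n) : ℚ) : ℝ) + 2 * s := by
      exact_mod_cast hF
    refine hF'.trans ?_
    have : ((harmonic (n + n) : ℚ) : ℝ) ≤ L := by rw [hlog] at hharm; linarith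
    have := mul_le_mul_of_nonneg_left this (Nat.cast_nonneg (α := ℝ) (n + n))
    push_cast at this ⊢
    linarith
  have hF₁ : (s * F : ℝ) ≤ 4 * n * L := by nlinarith
  rcases (show n = 1 ∨ 2 ≤ n by omega) with rfl | hn2
  · -- a single vertex: everything is bounded
    obtain rfl : s = 1 := le_antisymm hsn hs
    have hF₂ : F ≤ 8 := by
      norm_num [hL] at hF₁
      exact hF₁
    have hst : steps 1 m 1 F ≤ 50000 := by
      have hm1 : m ≤ 1 := by simpa using hmn
      have : F * (1 * 1 * 600 + m * 80 + 130) ≤ 8 * 810 := Nat.mul_le_mul hF₂ (by omega)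
      unfold steps
      omega
    have : (steps 1 m 1 F : ℝ) ≤ 50000 := by exact_mod_cast hst
    simpa using this
  · replace hm : n ≤ m := hm.resolve_left (by omega)
    have hn2' : (2 : ℝ) ≤ n := by exact_mod_cast hn2
    have hln2 : Real.log 2 ≤ Real.log n := Real.log_le_log (by norm_num) hn2'
    have hL' : L ≤ 4 * Real.log n := by rw [hL]; linarith
    set X : ℝ := (m : ℝ) ^ (2 / 3 : ℝ) * (n : ℝ) ^ (4 / 3 : ℝ) with hX
    have hX0 : 0 ≤ X := by positivity
    have hX₁ : (n : ℝ) ^ 2 * s ^ 2 ≤ X := sq_mul_sq_le (by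
      rcases h₁ with rfl | h₁
      · simpa using hm
      · exact h₁)
    have hX₂ : (m : ℝ) * n ≤ 2 * s * X := mul_le_size_mul hs h₂
    have hn2X : (n : ℝ) ^ 2 ≤ X :=
      (le_mul_of_one_le_right (by positivity) (one_le_pow₀ hs0)).trans hX₁
    have hnsX : (n : ℝ) ^ 2 * s ≤ X :=
      (mul_le_mul_of_nonneg_left (le_self_pow₀ hs0 (by norm_num)) (by positivity)).trans hX₁
    have hnX : (n : ℝ) ≤ X := (le_self_pow₀ hn0 (by norm_num)).trans hn2X
    have hmX : (m : ℝ) ≤ 2 * X := by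
      refine le_of_mul_le_mul_right (a := (n : ℝ)) (hX₂.trans ?_) (by linarith)
      nlinarith
    have hL0 : 0 ≤ L := by rw [hL]; linarith
    have hFns : (F : ℝ) * (n * s) ≤ 4 * (X * L) := by
      have h₃ := mul_le_mul_of_nonneg_left hF₁ (by linarith : (0 : ℝ) ≤ n)
      have h₄ := mul_le_mul_of_nonneg_right hn2X hL0
      nlinarith
    have hFm : (F : ℝ) * m ≤ 8 * (X * L) := by
      refine le_of_mul_le_mul_left (a := (s : ℝ)) ?_ (by linarith)
      have h₃ := mul_le_mul_of_nonneg_right hF₁ (Nat.cast_nonneg (α := ℝ) m)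
      have h₄ := mul_le_mul_of_nonneg_left hX₂ hL0
      nlinarith
    have hF1 : (F : ℝ) ≤ F * (n * s) :=
      le_mul_of_one_le_right (Nat.cast_nonneg _) (one_le_mul_of_one_le_of_one_le hn0 hs0)
    have hXL : X * L ≤ 4 * (X * Real.log n) := by
      have := mul_le_mul_of_nonneg_left hL' hX0
      linarith
    have hXl : X ≤ 2 * (X * Real.log n) := by
      have := mul_le_mul_of_nonneg_left (by linarith : (1 : ℝ) ≤ 2 * Real.log n) hX0
      linarith
    have hsteps : (steps n m s F : ℝ) = 30 * n + 100 * m + 600 * (n ^ 2 * s) +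
        600 * (F * (n * s)) + 80 * (F * m) + 130 * F + 200 * (n ^ 2 * s ^ 2) + 150 := by
      unfold steps
      push_cast
      ring
    rw [hsteps]
    linarith

end WordRAM

/-! ### Walks and distances in directed graphs -/

namespace Digraph

variable {V : Type*} {G : Digraph V}

theorem hasWalk_add {j k : ℕ} {u v : V} :
    G.HasWalk (j + k) u v ↔ ∃ x, G.HasWalk j u x ∧ G.HasWalk k x v := by
  induction j generalizing u with
  | zero => simp [HasWalk]
  | succ j ih =>
    rw [Nat.succ_add]
    simp only [HasWalk, ih]
    tauto

theorem edist_le_iff {k : ℕ} {u v : V} : G.edist u v ≤ k ↔ ∃ j ≤ k, G.HasWalk j u v := by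
  constructor
  · intro h
    by_contra! hc
    have : ((k + 1 : ℕ) : ℕ∞) ≤ G.edist u v := by
      refine le_iInf₂ fun j hj => ?_
      have : k < j := by
        by_contra hle
        exact hc j (not_lt.1 hle) hj
      exact_mod_cast this
    have := this.trans h
    norm_cast at this
    omega
  · rintro ⟨j, hj, hw⟩
    exact (iInf₂_le j hw).trans (by exact_mod_cast hj)

theorem hasWalk_of_edist_eq {k : ℕ} {u v : V} (h : G.edist u v = k) : G.HasWalk k u v := by
  obtain ⟨j, hj, hw⟩ := edist_le_iff.1 h.le
  have : (k : ℕ∞) ≤ j := h ▸ iInf₂_le j hw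
  norm_cast at this
  exact (le_antisymm hj this) ▸ hw

end Digraph

/-- The distance between the vertices of a graph, as a function on numbers. -/
noncomputable def numDist {n : ℕ} (G : Digraph (Fin n)) (u v : ℕ) : ℕ :=
  if h : u < n ∧ v < n then (G.edist ⟨u, h.1⟩ ⟨v, h.2⟩).toNat else 0

namespace WordRAM

section

variable {n : ℕ} {G : Digraph (Fin n)} {l : List (Fin n × Fin n)}

theorem coe_numDist (hfin : ∀ u v, G.edist u v ≠ ⊤) (u v : Fin n) :
    G.edist u v = numDist G u v := by
  simp [numDist, ENat.natCast_toNat (hfin u v)]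

theorem graphDist_numDist {A : ℕ → ℕ → Prop}
    (hA : ∀ u v, A u v ↔ ∃ x y, G.Adj x y ∧ x = u ∧ y = v)
    (hfin : ∀ u v, G.edist u v ≠ ⊤) : GraphDist n A (numDist G) := by
  have hle : ∀ {u v : Fin n} {k : ℕ}, numDist G u v ≤ k ↔ ∃ j ≤ k, G.HasWalk j u v := by
    intro u v k
    rw [← Digraph.edist_le_iff, coe_numDist hfin, Nat.cast_le]
  have hwalk : ∀ u v : Fin n, G.HasWalk (numDist G u v) u v := fun u v =>
    Digraph.hasWalk_of_edist_eq (coe_numDist hfin u v)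
  have htri : ∀ u v x : Fin n, numDist G u x ≤ numDist G u v + numDist G v x := fun u v x =>
    hle.2 ⟨_, le_rfl, Digraph.hasWalk_add.2 ⟨v, hwalk u v, hwalk v x⟩⟩
  have hadj : ∀ u v : Fin n, G.Adj u v → numDist G u v ≤ 1 := fun u v h =>
    hle.2 ⟨1, le_rfl, v, h, rfl⟩
  refine { zero := ?_, triangle := ?_, adj := ?_, pred := ?_, succ := ?_ }
  · intro u v hu hv
    constructor
    · intro h
      have := hwalk ⟨u, hu⟩ ⟨v, hv⟩
      rw [show numDist G (⟨u, hu⟩ : Fin n) (⟨v, hv⟩ : Fin n) = 0 from h] at this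
      exact congrArg Fin.val (show (⟨u, hu⟩ : Fin n) = ⟨v, hv⟩ from this)
    · rintro rfl
      exact Nat.le_zero.1 (hle (u := ⟨u, hu⟩) (v := ⟨u, hu⟩).2 ⟨0, le_rfl, rfl⟩)
  · intro u v x hu hv hx
    exact htri ⟨u, hu⟩ ⟨v, hv⟩ ⟨x, hx⟩
  · intro u v h
    obtain ⟨x, y, hxy, rfl, rfl⟩ := (hA u v).1 h
    exact hadj x y hxy
  · intro u v k hu hv h
    have hw := hwalk ⟨u, hu⟩ ⟨v, hv⟩
    rw [show numDist G (⟨u, hu⟩ : Fin n) (⟨v, hv⟩ : Fin n) = k + 1 from h,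
      Digraph.hasWalk_add] at hw
    obtain ⟨p, hp, y, hy, hyv⟩ := hw
    obtain rfl : y = ⟨v, hv⟩ := hyv
    refine ⟨p, p.2, (hA _ _).2 ⟨p, _, hy, rfl, rfl⟩, ?_⟩
    have h₁ : numDist G u p ≤ k := hle (u := ⟨u, hu⟩).2 ⟨k, le_rfl, hp⟩
    have h₂ : numDist G u v ≤ numDist G u p + numDist G p v := htri ⟨u, hu⟩ p ⟨v, hv⟩
    have h₃ : numDist G p v ≤ 1 := hadj p _ hy
    omega
  · intro u v k hu hv h
    have hw := hwalk ⟨u, hu⟩ ⟨v, hv⟩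
    rw [show numDist G (⟨u, hu⟩ : Fin n) (⟨v, hv⟩ : Fin n) = k + 1 from h] at hw
    obtain ⟨p, hp, hpv⟩ := hw
    refine ⟨p, p.2, (hA _ _).2 ⟨_, p, hp, rfl, rfl⟩, ?_⟩
    have h₁ : numDist G p v ≤ k := hle (v := ⟨v, hv⟩).2 ⟨k, le_rfl, hpv⟩
    have h₂ : numDist G u v ≤ numDist G u p + numDist G p v := htri ⟨u, hu⟩ p ⟨v, hv⟩
    have h₃ : numDist G u p ≤ 1 := hadj _ p hp
    omega

/-- In a strongly connected graph with at least two vertices, every vertex is the tail of an arc. -/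
theorem le_length_of_edist_ne_top (hl : IsArcList G.Adj l) (hn : 2 ≤ n)
    (hfin : ∀ u v, G.edist u v ≠ ⊤) : n ≤ l.length := by
  classical
  have hsub : (Finset.univ : Finset (Fin n)) ⊆ (l.map Prod.fst).toFinset := by
    intro u _
    obtain ⟨v, hv⟩ : ∃ v : Fin n, u ≠ v := by
      have : Nontrivial (Fin n) := Fin.nontrivial_iff_two_le.2 hn
      obtain ⟨v, hv⟩ := exists_ne u
      exact ⟨v, hv.symm⟩
    have hw := Digraph.hasWalk_of_edist_eq (coe_numDist hfin u v)
    rcases h : numDist G u v with _ | k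
    · rw [h] at hw
      exact absurd hw hv
    · rw [h] at hw
      obtain ⟨x, hx, -⟩ := hw
      simpa using ⟨x, (hl.2 u x).2 hx⟩
  have := (Finset.card_le_card hsub).trans (List.toFinset_card_le _)
  simpa using this

theorem arcAdj_iff (hl : IsArcList G.Adj l) (u v : ℕ) :
    ArcAdj l.length ((arcInput n l).arr 0) ((arcInput n l).arr 1) u v ↔
      ∃ x y : Fin n, G.Adj x y ∧ (x : ℕ) = u ∧ (y : ℕ) = v := by
  constructor
  · rintro ⟨i, hi, rfl, rfl⟩
    refine ⟨l[i].1, l[i].2, (hl.2 _ _).1 (List.getElem_mem hi), ?_, ?_⟩ <;> simp [arcInput, hi]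
  · rintro ⟨x, y, hxy, rfl, rfl⟩
    obtain ⟨i, hi, h⟩ := List.getElem_of_mem ((hl.2 x y).2 hxy)
    exact ⟨i, hi, by simp [arcInput, hi, h], by simp [arcInput, hi, h]⟩

theorem length_le_sq (hl : IsArcList G.Adj l) : l.length ≤ n * n := by
  simpa using hl.1.length_le_card

/-- The algorithm is correct and fast on directed graphs. -/
theorem reportsWithin_diameter {w h z : ℕ} (hn : 0 < n) (hz : z ≤ 2) (hw : (n + 2) ^ 4 ≤ 2 ^ w)
    (hl : IsArcList G.Adj l) (hG : G.ediam = ((3 * h + z : ℕ) : ℕ∞)) {T : ℝ}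
    (hT : 50000 * ((l.length : ℝ) ^ (2 / 3 : ℝ) * (n : ℝ) ^ (4 / 3 : ℝ) * Real.log n + 1) ≤ T) :
    ∃ d : ℕ, ReportsWithin diameter w n l T d ∧ 2 * h + z ≤ d ∧ d ≤ 3 * h + z := by
  have hle : ∀ u v, G.edist u v ≤ ((3 * h + z : ℕ) : ℕ∞) := fun u v =>
    hG ▸ le_iSup₂ (f := fun u v => G.edist u v) u v
  have hfin : ∀ u v, G.edist u v ≠ ⊤ := fun u v =>
    ne_top_of_le_ne_top (ENat.natCast_ne_top _) (hle u v)
  have hne : Nonempty (Fin n) := ⟨⟨0, hn⟩⟩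
  obtain ⟨a, b, hab⟩ : ∃ a b, G.edist a b = ((3 * h + z : ℕ) : ℕ∞) := by
    obtain ⟨a, ha⟩ := exists_eq_ciSup_of_finite (f := fun u => ⨆ v, G.edist u v)
    obtain ⟨b, hb⟩ := exists_eq_ciSup_of_finite (f := fun v => G.edist a v)
    exact ⟨a, b, hb.trans (ha.trans hG)⟩
  have hS : Setting w n l.length 1 ((arcInput n l).arr 0) ((arcInput n l).arr 1) (numDist G) := by
    refine ⟨hn, hw, fun i hi => ?_, fun i hi => ?_, fun i hi j hj h₁ h₂ => ?_, length_le_sq hl,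
      graphDist_numDist (arcAdj_iff hl) hfin, le_rfl, hn⟩
    · simp [arcInput, hi]
    · simp [arcInput, hi]
    · simp only [arcInput, List.getElem?_eq_getElem hi, List.getElem?_eq_getElem hj, if_true,
        one_ne_zero, if_false] at h₁ h₂
      exact (hl.1.getElem_inj_iff).1 (Prod.ext (Fin.ext h₁) (Fin.ext h₂))
  have hzero : ∀ a, a ≠ 0 → a ≠ 1 → (arcInput n l).arr a = fun _ => 0 := by
    intro a h₀ h₁
    funext i
    simp only [arcInput, if_neg h₀, if_neg h₁]
    split <;> rfl
  obtain ⟨t, τ, hE, ⟨s, F, hs₁, hs₂, hs₃, hs₄, hF, ht⟩, h₁, h₂⟩ :=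
    wp_diameter (D := 3 * h + z) hS rfl rfl rfl rfl (hzero _ (by decide) (by decide))
      (hzero _ (by decide) (by decide)) (hzero _ (by decide) (by decide)) rfl
      (fun u hu v hv => by
        have := hle ⟨u, hu⟩ ⟨v, hv⟩
        rw [coe_numDist hfin] at this
        exact_mod_cast this) a.2 b.2 hz (by
        rw [coe_numDist hfin] at hab
        exact_mod_cast hab)
  refine ⟨τ.var 0, ⟨t, τ, hE, ?_, rfl⟩, h₁, h₂⟩
  refine le_trans ?_ hT
  refine le_trans (Nat.cast_le.2 ht) (steps_le hn (length_le_sq hl) ?_ hs₁ hs₂ hs₃ hs₄ hF)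
  rcases (show n = 1 ∨ 2 ≤ n by omega) with h | h
  · exact .inl h
  · exact .inr (le_length_of_edist_ne_top hl h hfin)

theorem length_eq_numArcs (hl : IsArcList G.Adj l) : l.length = G.numArcs := by
  classical
  have : {e : Fin n × Fin n | G.Adj e.1 e.2} = (l.toFinset : Set (Fin n × Fin n)) := by
    ext ⟨u, v⟩
    simp [hl.2 u v]
  rw [Digraph.numArcs, this, Set.ncard_coe_finset, List.toFinset_card_of_nodup hl.1]

end

/-! ### Undirected graphs -/

section

variable {n : ℕ} {G : SimpleGraph (Fin n)} {l : List (Fin n × Fin n)}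

theorem hasWalk_iff_exists_walk {V : Type*} {G : SimpleGraph V} {k : ℕ} {u v : V} :
    (Digraph.mk G.Adj).HasWalk k u v ↔ ∃ p : G.Walk u v, p.length = k := by
  induction k generalizing u with
  | zero =>
    constructor
    · rintro rfl
      exact ⟨.nil, rfl⟩
    · rintro ⟨p, hp⟩
      exact SimpleGraph.Walk.eq_of_length_eq_zero hp
  | succ k ih =>
    constructor
    · rintro ⟨x, hx, h⟩
      obtain ⟨p, rfl⟩ := ih.1 h
      exact ⟨.cons hx p, rfl⟩
    · rintro ⟨p, hp⟩
      cases p with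
      | nil => simp at hp
      | cons hx p => exact ⟨_, hx, ih.2 ⟨p, by simpa using hp⟩⟩

theorem ediam_mk_adj {V : Type*} (G : SimpleGraph V) : (Digraph.mk G.Adj).ediam = G.ediam := by
  rw [SimpleGraph.ediam_eq_iSup_iSup_edist, Digraph.ediam]
  refine iSup_congr fun u => iSup_congr fun v => le_antisymm ?_ ?_
  · exact le_iInf fun p => Digraph.edist_le_iff.2 ⟨_, le_rfl, hasWalk_iff_exists_walk.2 ⟨p, rfl⟩⟩
  · refine le_iInf₂ fun k hk => ?_
    obtain ⟨p, rfl⟩ := hasWalk_iff_exists_walk.1 hk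
    exact iInf_le _ p

theorem length_eq_two_mul_ncard_edgeSet (hl : IsArcList G.Adj l) :
    l.length = 2 * G.edgeSet.ncard := by
  classical
  have : l.toFinset = Finset.univ.filter fun e : Fin n × Fin n => G.Adj e.1 e.2 := by
    ext ⟨u, v⟩
    simp [hl.2 u v]
  rw [← List.toFinset_card_of_nodup hl.1, this, ← SimpleGraph.coe_edgeFinset,
    Set.ncard_coe_finset, SimpleGraph.two_mul_card_edgeFinset]

end

end WordRAM

theorem mainTheorem5 :
    ∃ (P : WordRAM.Program) (c : ℕ) (C : ℝ) (k : ℕ), ∀ (n h z w : ℕ), 0 < n → z ≤ 2 →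
      (n + 2) ^ c ≤ 2 ^ w →
      (∀ (G : Digraph (Fin n)) (l : List (Fin n × Fin n)),
        IsArcList G.Adj l → G.ediam = ((3 * h + z : ℕ) : ℕ∞) →
        ∃ d : ℕ,
          ReportsWithin P w n l
            (C * ((G.numArcs : ℝ) ^ (2 / 3 : ℝ) * (n : ℝ) ^ (4 / 3 : ℝ) * Real.log n ^ k + 1)) d ∧
          2 * h + z ≤ d ∧ d ≤ 3 * h + z) ∧
      (∀ (G : SimpleGraph (Fin n)) (l : List (Fin n × Fin n)),
        IsArcList G.Adj l → G.ediam = ((3 * h + z : ℕ) : ℕ∞) →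
        ∃ d : ℕ,
          ReportsWithin P w n l
            (C * ((G.edgeSet.ncard : ℝ) ^ (2 / 3 : ℝ) * (n : ℝ) ^ (4 / 3 : ℝ) * Real.log n ^ k + 1))
            d ∧
          2 * h + z ≤ d ∧ d ≤ 3 * h + z) := by
  refine ⟨WordRAM.diameter, 4, 100000, 1, fun n h z w hn hz hw => ⟨fun G l hl hG => ?_,
    fun G l hl hG => ?_⟩⟩
  · refine WordRAM.reportsWithin_diameter hn hz hw hl hG ?_
    rw [WordRAM.length_eq_numArcs hl, pow_one]
    have : 0 ≤ Real.log n := Real.log_natCast_nonneg n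
    gcongr
    norm_num
  · refine WordRAM.reportsWithin_diameter (G := ⟨G.Adj⟩) hn hz hw hl
      ((WordRAM.ediam_mk_adj G).trans hG) ?_
    rw [WordRAM.length_eq_two_mul_ncard_edgeSet hl, pow_one, Nat.cast_mul,
      Real.mul_rpow (by norm_num) (Nat.cast_nonneg _)]
    have h₁ : ((2 : ℕ) : ℝ) ^ (2 / 3 : ℝ) ≤ 2 := by
      simpa using Real.rpow_le_rpow_of_exponent_le (by norm_num : (1 : ℝ) ≤ 2)
        (by norm_num : (2 / 3 : ℝ) ≤ 1)
    have h₂ : 0 ≤ (G.edgeSet.ncard : ℝ) ^ (2 / 3 : ℝ) * (n : ℝ) ^ (4 / 3 : ℝ) * Real.log n :=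
      mul_nonneg (by positivity) (Real.log_natCast_nonneg n)
    have h₃ := mul_le_mul_of_nonneg_right h₁ h₂
    linarith
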